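/- Let $k$ be a field, let $A$ be a unital associative $k$-algebra and let $B\subseteq A$ be a $k$-subalgebra. For a $(B,B)$-bimodule $X$ put $X_B=X/[X,B]$, where $[X,B]$ is the subspace spanned by the elements $xb-bx$. For an $(A,A)$-bimodule $M$ (a left module over $A\otimes_k A^{op}$) put $$Z_n(A/B,M)=\bigl(M\otimes_B A\otimes_B\cdots\otimes_B A\bigr)_B\qquad(n\text{ factors }A),$$ with face maps $d_i\colon Z_{n}(A/B,M)\to Z_{n-1}(A/B,M)$, $0\le i\le n$, given on the class of $(m,a_1,\dots,a_n)$ by $d_0=(ma_1,a_2,\dots,a_n)$, $d_i=(m,a_1,\dots,a_ia_{i+1},\dots,a_n)$ for $0<i<n$, and $d_n=(a_nm,a_1,\dots,a_{n-1})$. The Hochschild homology $HH_*(A/B,M)$ is the homology of the complex $(Z_*(A/B,M),b)$, $b=\sum_{i=0}^n(-1)^id_i$. For $M=A$ let $t_n(a_0,\dots,a_n)=(a_n,a_0,\dots,a_{n-1})$ and $T=(-1)^nt_n$. The cyclic homology $HC_*(A/B)$ is the homology of the total complex of the Tsygan double complex (with entry $Z_q(A/B,A)$ in position $(p,q)$,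 $p,q\ge0$), whose even columns have differential $b$, whose odd columns have differential $-b'$ with $b'=\sum_{i=0}^{n-1}(-1)^id_i$, and whose horizontal maps are $1-T$ from odd to even columns and $1+T+\cdots+T^q$ (in row $q$) from even to odd columns. Write $HH_*(A,M)=HH_*(A/k,M)$ and $HC_*(A)=HC_*(A/k)$, where $k$ stands for the subalgebra $k\cdot 1\subseteq A$. Assume that $B$ is a separable $k$-algebra, that is, the multiplication map $B\otimes_kB\to B$ has a section which is a morphism of $(B,B)$-bimodules. Then for every $(A,A)$-bimodule $M$ and every $n\ge0$ the canonical projections $Z_*(A/k,M)\to Z_*(A/B,M)$ induce isomorphisms $$HH_n(A,M)\;\cong\;HH_n(A/B,M),\qquad HC_n(A)\;\cong\;HC_n(A/B)$$ (with $M=A$ in the second case). -/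

import Mathlib

open CategoryTheory TensorProduct MulOpposite

universe u v w

/-- A `k`-algebra `R` (not necessarily commutative) is separable if the multiplication map
`R ⊗[k] R → R` has a section which is a morphism of `(R, R)`-bimodules. -/
def IsSeparableAlg (k : Type u) (R : Type v) [CommRing k] [Ring R] [Algebra k R] : Prop :=
  ∃ s : R →ₗ[k] R ⊗[k] R,
    (∀ r x : R, s (r * x) = (LinearMap.mulLeft k r).rTensor R (s x)) ∧
    (∀ x r : R, s (x * r) = (LinearMap.mulRight k r).lTensor R (s x)) ∧
    (∀ x : R, LinearMap.mul' k R (s x) = x)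

namespace RelCyclic

set_option linter.unusedSectionVars false
set_option linter.unreachableTactic false
set_option linter.unusedTactic false
set_option linter.flexible false
set_option linter.unnecessarySimpa false
set_option linter.unusedSimpArgs false

/-! ### Operations on tuples `(m, a₁, …, aₙ)` with `m ∈ M` and `aᵢ ∈ A`

The entry `m` sits in slot `0` and `a i`, for `i : Fin n`, sits in slot `i + 1`. -/

section Tuples

variable {A : Type v} {M : Type w} [Ring A] [AddCommGroup M] [Module A M] [Module Aᵐᵒᵖ M]

/-- Multiply the entry in slot `j` by `b` on the right. -/
def actRight {n : ℕ} (j : Fin (n + 1)) (b : A) (x : M × (Fin n → A)) : M × (Fin n → A) :=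
  (if (j : ℕ) = 0 then op b • x.1 else x.1,
    fun i => if (i : ℕ) + 1 = j then x.2 i * b else x.2 i)

/-- Multiply the entry in the slot that follows `j` in the cyclic order by `b` on the left. -/
def actLeft {n : ℕ} (j : Fin (n + 1)) (b : A) (x : M × (Fin n → A)) : M × (Fin n → A) :=
  (if (j : ℕ) = n then b • x.1 else x.1,
    fun i => if (i : ℕ) = j then b * x.2 i else x.2 i)

/-- The `i`-th face of `(m, a₁, …, aₙ₊₁)`: it is `(m a₁, a₂, …, aₙ₊₁)` for `i = 0`,
`(m, a₁, …, aᵢ aᵢ₊₁, …, aₙ₊₁)` for `0 < i < n + 1`, and `(aₙ₊₁ m, a₁, …, aₙ)` for `i = n + 1`. -/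
def faceTuple {n : ℕ} (i : Fin (n + 2)) (x : M × (Fin (n + 1) → A)) : M × (Fin n → A) :=
  (if (i : ℕ) = 0 then op (x.2 0) • x.1
    else if (i : ℕ) = n + 1 then x.2 (Fin.last n) • x.1 else x.1,
    fun l => if (l : ℕ) + 1 < i then x.2 l.castSucc
      else if (l : ℕ) + 1 = i then x.2 l.castSucc * x.2 l.succ else x.2 l.succ)

/-- The cyclic rotation `(a₀, a₁, …, aₙ) ↦ (aₙ, a₀, …, aₙ₋₁)`. -/
def rotTuple : {n : ℕ} → A × (Fin n → A) → A × (Fin n → A)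
  | 0, x => x
  | n + 1, x => (x.2 (Fin.last n), Fin.cons x.1 fun i : Fin n => x.2 i.castSucc)

end Tuples

section Tensor

variable (k : Type u) {A : Type v} [CommRing k] [Ring A] [Algebra k A]
variable (M : Type w) [AddCommGroup M] [Module k M]

/-- The elementary tensor `m ⊗ a₁ ⊗ ⋯ ⊗ aₙ`. -/
noncomputable def pureT {n : ℕ} (x : M × (Fin n → A)) : M ⊗[k] (⨂[k] _ : Fin n, A) :=
  x.1 ⊗ₜ[k] PiTensorProduct.tprod k x.2

/-- Functions of tuples that are linear in every entry. -/
structure IsMultilin {n : ℕ} {Q : Type*} [AddCommGroup Q] [Module k Q]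
    (f : M × (Fin n → A) → Q) : Prop where
  add_left : ∀ m m' a, f (m + m', a) = f (m, a) + f (m', a)
  smul_left : ∀ (c : k) m a, f (c • m, a) = c • f (m, a)
  add_right : ∀ m a (i : Fin n) (y z : A),
    f (m, Function.update a i (y + z)) =
      f (m, Function.update a i y) + f (m, Function.update a i z)
  smul_right : ∀ m a (i : Fin n) (c : k) (y : A),
    f (m, Function.update a i (c • y)) = c • f (m, Function.update a i y)

variable {k M}

theorem isMultilin_pureT {n : ℕ} : IsMultilin k M (pureT k M (A := A) (n := n)) where
  add_left m m' a := TensorProduct.add_tmul _ _ _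
  smul_left c m a := TensorProduct.smul_tmul' _ _ _
  add_right m a i y z := by simp [pureT, TensorProduct.tmul_add]
  smul_right m a i c y := by simp [pureT]

/-- The linear map on `M ⊗ A ⊗ ⋯ ⊗ A` induced by a function linear in every entry. -/
noncomputable def liftT {n : ℕ} {Q : Type*} [AddCommGroup Q] [Module k Q]
    (f : M × (Fin n → A) → Q) (hf : IsMultilin k M f) :
    M ⊗[k] (⨂[k] _ : Fin n, A) →ₗ[k] Q :=
  TensorProduct.lift
    { toFun := fun m => PiTensorProduct.lift
        { toFun := fun a => f (m, a)
          map_update_add' := by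
            intro inst a i y z
            obtain rfl := Subsingleton.elim inst (instDecidableEqFin n)
            exact hf.add_right m a i y z
          map_update_smul' := by
            intro inst a i c y
            obtain rfl := Subsingleton.elim inst (instDecidableEqFin n)
            exact hf.smul_right m a i c y }
      map_add' := by
        intro m m'
        apply PiTensorProduct.ext
        ext a
        simp [hf.add_left]
      map_smul' := by
        intro c m
        apply PiTensorProduct.ext
        ext a
        simp [hf.smul_left] }

@[simp] theorem liftT_pureT {n : ℕ} {Q : Type*} [AddCommGroup Q] [Module k Q]
    (f : M × (Fin n → A) → Q) (hf : IsMultilin k M f) (x : M × (Fin n → A)) :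
    liftT f hf (pureT k M x) = f x := by
  simp [liftT, pureT]

theorem hom_ext_pureT {n : ℕ} {Q : Type*} [AddCommGroup Q] [Module k Q]
    {f g : M ⊗[k] (⨂[k] _ : Fin n, A) →ₗ[k] Q}
    (h : ∀ x, f (pureT k M x) = g (pureT k M x)) : f = g := by
  apply TensorProduct.ext
  ext m : 1
  apply PiTensorProduct.ext
  ext a
  exact h (m, a)

end Tensor

section Chains

variable {k : Type u} {A : Type v} [CommRing k] [Ring A] [Algebra k A] (B : Subalgebra k A)
variable (M : Type w) [AddCommGroup M] [Module k M] [Module A M] [Module Aᵐᵒᵖ M]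
  [IsScalarTower k A M] [IsScalarTower k Aᵐᵒᵖ M] [SMulCommClass A Aᵐᵒᵖ M]

/-- The relations defining `M ⊗_B A ⊗_B ⋯ ⊗_B A` (an element of `B` moves between two
neighbouring slots), together with the commutators `x b - b x` (an element of `B` moves from
the last slot to slot `0`). -/
noncomputable def relations (n : ℕ) : Submodule k (M ⊗[k] (⨂[k] _ : Fin n, A)) :=
  Submodule.span k {y | ∃ (j : Fin (n + 1)) (b : A) (x : M × (Fin n → A)), b ∈ B ∧
    y = pureT k M (actRight j b x) - pureT k M (actLeft j b x)}

/-- The cyclic tensor product `Zₙ(A/B, M) = M ⊗̂_B A ⊗̂_B ⋯ ⊗̂_B A` (with `n` factors `A`), that is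
`X / [X, B]` for `X = M ⊗_B A ⊗_B ⋯ ⊗_B A`. -/
abbrev Z (n : ℕ) : Type max u v w :=
  (M ⊗[k] (⨂[k] _ : Fin n, A)) ⧸ relations B M n

variable {M}

/-- The class of `m ⊗ a₁ ⊗ ⋯ ⊗ aₙ`. -/
noncomputable def cls {n : ℕ} (x : M × (Fin n → A)) : Z B M n :=
  (relations B M n).mkQ (pureT k M x)

variable {B}

theorem cls_actRight {n : ℕ} (j : Fin (n + 1)) {b : A} (hb : b ∈ B) (x : M × (Fin n → A)) :
    cls B (actRight j b x) = cls B (actLeft j b x) := by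
  rw [cls, cls, ← sub_eq_zero, ← map_sub]
  exact (Submodule.Quotient.mk_eq_zero _).2 (Submodule.subset_span ⟨j, b, x, hb, rfl⟩)

theorem isMultilin_cls {n : ℕ} : IsMultilin k M (cls (k := k) (M := M) B (n := n)) where
  add_left m m' a := by simp only [cls, isMultilin_pureT.add_left, map_add]
  smul_left c m a := by simp only [cls, isMultilin_pureT.smul_left, map_smul]
  add_right m a i y z := by simp only [cls, isMultilin_pureT.add_right, map_add]
  smul_right m a i c y := by simp only [cls, isMultilin_pureT.smul_right, map_smul]

variable (B) in
/-- The linear map on `Zₙ(A/B, M)` induced by a function which is linear in every entry and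
compatible with the relations. -/
noncomputable def liftZ {n : ℕ} {Q : Type*} [AddCommGroup Q] [Module k Q]
    (f : M × (Fin n → A) → Q) (hf : IsMultilin k M f)
    (h : ∀ (j : Fin (n + 1)) (b : A) (x : M × (Fin n → A)), b ∈ B →
      f (actRight j b x) = f (actLeft j b x)) : Z B M n →ₗ[k] Q :=
  (relations B M n).liftQ (liftT f hf) (by
    rw [relations, Submodule.span_le]
    rintro _ ⟨j, b, x, hb, rfl⟩
    simp [h j b x hb])

@[simp] theorem liftZ_cls {n : ℕ} {Q : Type*} [AddCommGroup Q] [Module k Q]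
    (f : M × (Fin n → A) → Q) (hf : IsMultilin k M f)
    (h : ∀ (j : Fin (n + 1)) (b : A) (x : M × (Fin n → A)), b ∈ B →
      f (actRight j b x) = f (actLeft j b x)) (x : M × (Fin n → A)) :
    liftZ B f hf h (cls B x) = f x := by
  simp [liftZ, cls]

theorem hom_ext_cls {n : ℕ} {Q : Type*} [AddCommGroup Q] [Module k Q]
    {f g : Z B M n →ₗ[k] Q} (h : ∀ x, f (cls B x) = g (cls B x)) : f = g := by
  apply Submodule.linearMap_qext
  exact hom_ext_pureT h

/-! ### Face maps -/

theorem faceTuple_update_zero {n : ℕ} (m : M) (a : Fin (n + 1) → A) (y : A) :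
    faceTuple (0 : Fin (n + 2)) (m, Function.update a 0 y) =
      (op y • m, fun l => a l.succ) := by
  simp [faceTuple]

theorem faceTuple_update_last {n : ℕ} (m : M) (a : Fin (n + 1) → A) (y : A) :
    faceTuple (Fin.last (n + 1)) (m, Function.update a (Fin.last n) y) =
      (y • m, fun l => a l.castSucc) := by
  ext <;> simp [faceTuple]

/-- Apart from the two cases above, updating an entry changes one entry of the face, through a
linear map. -/
theorem exists_faceTuple_update {n : ℕ} (i : Fin (n + 2)) (p : Fin (n + 1))
    (h0 : ¬ (i = 0 ∧ p = 0)) (h1 : ¬ (i = Fin.last (n + 1) ∧ p = Fin.last n))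
    (m : M) (a : Fin (n + 1) → A) :
    ∃ (m' : M) (a' : Fin n → A) (q : Fin n) (L : A →ₗ[k] A), ∀ y,
      faceTuple i (m, Function.update a p y) = (m', Function.update a' q (L y)) := by
  refine ⟨(faceTuple i (m, a)).1, (faceTuple i (m, a)).2, ?_⟩
  rcases i with ⟨i, hi⟩
  rcases p with ⟨p, hp⟩
  simp only [Fin.ext_iff, Fin.val_zero, Fin.val_last] at h0 h1
  have hm : ∀ y, (faceTuple (⟨i, hi⟩ : Fin (n + 2)) (m, Function.update a ⟨p, hp⟩ y)).1 =
      (faceTuple ⟨i, hi⟩ (m, a)).1 := by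
    intro y
    simp only [faceTuple, Function.update_apply, Fin.ext_iff, Fin.val_zero, Fin.val_last]
    split_ifs <;> first | rfl | omega
  by_cases c1 : p + 1 < i
  · refine ⟨⟨p, by omega⟩, LinearMap.id, fun y => Prod.ext (hm y) (funext fun l => ?_)⟩
    simp only [faceTuple, Function.update_apply, Fin.ext_iff, Fin.val_castSucc, Fin.val_succ,
      LinearMap.id_apply]
    split_ifs <;> first | rfl | omega
  by_cases c2 : p + 1 = i
  · refine ⟨⟨p, by omega⟩, LinearMap.mulRight k (a ⟨p + 1, by omega⟩),
      fun y => Prod.ext (hm y) (funext fun l => ?_)⟩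
    simp only [faceTuple, Function.update_apply, Fin.ext_iff, Fin.val_castSucc, Fin.val_succ,
      LinearMap.mulRight_apply]
    split_ifs <;> first | rfl | omega | skip
    rename_i h _ _
    congr 2
    ext
    simp
    omega
  by_cases c3 : p = i
  · refine ⟨⟨p - 1, by omega⟩, LinearMap.mulLeft k (a ⟨p - 1, by omega⟩),
      fun y => Prod.ext (hm y) (funext fun l => ?_)⟩
    simp only [faceTuple, Function.update_apply, Fin.ext_iff, Fin.val_castSucc, Fin.val_succ,
      LinearMap.mulLeft_apply]
    split_ifs <;> first | rfl | omega | skip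
    rename_i h _ _
    congr 2
    ext
    simp
    omega
  · refine ⟨⟨p - 1, by omega⟩, LinearMap.id, fun y => Prod.ext (hm y) (funext fun l => ?_)⟩
    simp only [faceTuple, Function.update_apply, Fin.ext_iff, Fin.val_castSucc, Fin.val_succ,
      LinearMap.id_apply]
    split_ifs <;> first | rfl | omega

theorem isMultilin_face {n : ℕ} (i : Fin (n + 2)) :
    IsMultilin k M fun x : M × (Fin (n + 1) → A) => cls B (faceTuple i x) := by
  have hc := isMultilin_cls (k := k) (M := M) (B := B) (n := n)
  constructor
  · intro m m' a
    have e : ∀ m : M, faceTuple i (m, a) =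
        ((faceTuple i (m, a)).1, (faceTuple i ((0 : M), a)).2) :=
      fun m => rfl
    rw [e (m + m'), e m, e m']
    rw [← hc.add_left]
    congr 2
    simp only [faceTuple]
    split_ifs <;> simp
  · intro c m a
    have e : ∀ m : M, faceTuple i (m, a) =
        ((faceTuple i (m, a)).1, (faceTuple i ((0 : M), a)).2) :=
      fun m => rfl
    rw [e (c • m), e m]
    rw [← hc.smul_left]
    congr 2
    simp only [faceTuple]
    split_ifs <;> first | rfl | (rw [smul_comm])
  · intro m a p y z
    by_cases h0 : i = 0 ∧ p = 0
    · obtain ⟨rfl, rfl⟩ := h0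
      simp only [faceTuple_update_zero]
      rw [← hc.add_left, MulOpposite.op_add, add_smul]
    by_cases h1 : i = Fin.last (n + 1) ∧ p = Fin.last n
    · obtain ⟨rfl, rfl⟩ := h1
      simp only [faceTuple_update_last]
      rw [← hc.add_left, add_smul]
    obtain ⟨m', a', q, L, h⟩ := exists_faceTuple_update (k := k) i p h0 h1 m a
    simp only [h, map_add, hc.add_right]
  · intro m a p c y
    by_cases h0 : i = 0 ∧ p = 0
    · obtain ⟨rfl, rfl⟩ := h0
      simp only [faceTuple_update_zero]
      rw [← hc.smul_left, MulOpposite.op_smul, smul_assoc]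
    by_cases h1 : i = Fin.last (n + 1) ∧ p = Fin.last n
    · obtain ⟨rfl, rfl⟩ := h1
      simp only [faceTuple_update_last]
      rw [← hc.smul_left, smul_assoc]
    obtain ⟨m', a', q, L, h⟩ := exists_faceTuple_update (k := k) i p h0 h1 m a
    simp only [h, map_smul, hc.smul_right]

theorem face_compat {n : ℕ} (i : Fin (n + 2)) (j : Fin (n + 2)) (b : A)
    (x : M × (Fin (n + 1) → A)) (hb : b ∈ B) :
    cls B (faceTuple i (actRight j b x)) = cls B (faceTuple i (actLeft j b x)) := by
  rcases i with ⟨i, hi⟩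
  rcases j with ⟨j, hj⟩
  obtain ⟨m, a⟩ := x
  have key : ∀ j' : Fin (n + 1),
      faceTuple ⟨i, hi⟩ (actRight (⟨j, hj⟩ : Fin (n + 2)) b (m, a)) =
        actRight j' b (faceTuple ⟨i, hi⟩ (m, a)) →
      faceTuple ⟨i, hi⟩ (actLeft (⟨j, hj⟩ : Fin (n + 2)) b (m, a)) =
        actLeft j' b (faceTuple ⟨i, hi⟩ (m, a)) →
      cls B (faceTuple ⟨i, hi⟩ (actRight (⟨j, hj⟩ : Fin (n + 2)) b (m, a))) =
      cls B (faceTuple ⟨i, hi⟩ (actLeft (⟨j, hj⟩ : Fin (n + 2)) b (m, a))) := by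
    intro j' h1 h2
    rw [h1, h2, cls_actRight j' hb]
  rcases lt_trichotomy j i with c | c | c
  · refine key ⟨j, by omega⟩ ?_ ?_
    · refine Prod.ext ?_ (funext fun l => ?_)
      · rcases i with _ | i <;> rcases j with _ | _ | j <;> simp [faceTuple, actRight] <;>
          (repeat' first | rfl | omega | (simp [smul_smul, mul_assoc, smul_comm]; done) | split)
      · simp only [faceTuple, actRight, Fin.val_castSucc, Fin.val_succ]
        split_ifs <;> first | rfl | omega | simp [mul_assoc]
    · refine Prod.ext ?_ (funext fun l => ?_)
      · rcases i with _ | i <;> rcases j with _ | _ | j <;> simp [faceTuple, actLeft] <;>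
          (repeat' first | rfl | omega | (simp [smul_smul, mul_assoc, smul_comm]; done) | split)
      · simp only [faceTuple, actLeft, Fin.val_castSucc, Fin.val_succ]
        split_ifs <;> first | rfl | omega | simp [mul_assoc]
  · subst c
    congr 1
    refine Prod.ext ?_ (funext fun l => ?_)
    · rcases j with _ | _ | j <;> simp [faceTuple, actRight, actLeft] <;>
        (repeat' first | rfl | omega | (simp [smul_smul, mul_assoc, smul_comm]; done) | split)
    · simp only [faceTuple, actRight, actLeft, Fin.val_castSucc, Fin.val_succ]
      split_ifs <;> first | rfl | omega | simp [mul_assoc]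
  · refine key ⟨j - 1, by omega⟩ ?_ ?_
    · refine Prod.ext ?_ (funext fun l => ?_)
      · rcases i with _ | i <;> rcases j with _ | _ | j <;> simp [faceTuple, actRight] <;>
          (repeat' first | rfl | omega | (simp [smul_smul, mul_assoc, smul_comm]; done) | split)
      · simp only [faceTuple, actRight, Fin.val_castSucc, Fin.val_succ]
        split_ifs <;> first | rfl | omega | simp [mul_assoc]
    · refine Prod.ext ?_ (funext fun l => ?_)
      · rcases i with _ | i <;> rcases j with _ | _ | j <;> simp [faceTuple, actLeft] <;>
          (repeat' first | rfl | omega | (simp [smul_smul, mul_assoc, smul_comm]; done) | split)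
      · simp only [faceTuple, actLeft, Fin.val_castSucc, Fin.val_succ]
        split_ifs <;> first | rfl | omega | simp [mul_assoc]

variable (B M) in
/-- The face map `dᵢ : Zₙ₊₁(A/B, M) → Zₙ(A/B, M)`. -/
noncomputable def face {n : ℕ} (i : Fin (n + 2)) : Z B M (n + 1) →ₗ[k] Z B M n :=
  liftZ B (fun x => cls B (faceTuple i x)) (isMultilin_face i) (fun j b x hb =>
    face_compat i j b x hb)

@[simp] theorem face_cls {n : ℕ} (i : Fin (n + 2)) (x : M × (Fin (n + 1) → A)) :
    face B M i (cls B x) = cls B (faceTuple i x) := by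
  simp [face]

theorem faceTuple_faceTuple {n : ℕ} (i j : Fin (n + 2)) (hij : i ≤ j)
    (x : M × (Fin (n + 2) → A)) :
    faceTuple i (faceTuple j.succ x) = faceTuple j (faceTuple i.castSucc x) := by
  rcases i with ⟨i, hi⟩
  rcases j with ⟨j, hj⟩
  obtain ⟨m, a⟩ := x
  simp only [Fin.mk_le_mk] at hij
  refine Prod.ext ?_ (funext fun l => ?_)
  · rcases i with _ | i <;> rcases j with _ | j <;> simp [faceTuple] <;>
      (repeat' first | rfl | omega | (simp [smul_smul, mul_assoc, smul_comm]; done) | split)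
  · simp only [faceTuple, Fin.val_castSucc, Fin.val_succ]
    split_ifs <;> first | rfl | omega | simp [mul_assoc]

/-! ### The cyclic operator -/

theorem isMultilin_rot {n : ℕ} :
    IsMultilin k A fun x : A × (Fin n → A) => cls (k := k) B (rotTuple x) := by
  have hc := isMultilin_cls (k := k) (M := A) (B := B) (n := n)
  cases n with
  | zero => exact hc
  | succ n =>
    have e0 : ∀ (m y : A) (a : Fin n → A),
        (Fin.cons y a : Fin (n + 1) → A) = Function.update (Fin.cons m a) 0 y := by
      intro m y a
      rw [Fin.update_cons_zero]
    have e1 : ∀ (m y : A) (a : Fin (n + 1) → A),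
        rotTuple (m, Function.update a (Fin.last n) y) =
          (y, Fin.cons m fun i : Fin n => a i.castSucc) := by
      intro m y a
      simp [rotTuple, Function.update_apply, Fin.ext_iff, Nat.ne_of_lt]
    have e2 : ∀ (m y : A) (a : Fin (n + 1) → A) (q : Fin n),
        rotTuple (m, Function.update a q.castSucc y) =
          (a (Fin.last n),
            Function.update (Fin.cons m fun i : Fin n => a i.castSucc : Fin (n + 1) → A)
              q.succ y) := by
      intro m y a q
      simp only [rotTuple]
      refine Prod.ext ?_ ?_
      · have : Fin.last n ≠ q.castSucc := (Fin.castSucc_lt_last q).ne'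
        simp [this]
      · dsimp only
        rw [← Fin.cons_update]
        congr 1
        funext i
        simp [Function.update_apply]
    constructor
    · intro m m' a
      simp only [rotTuple]
      rw [e0 0 (m + m'), hc.add_right, ← e0, ← e0]
    · intro c m a
      simp only [rotTuple]
      rw [e0 0 (c • m), hc.smul_right, ← e0]
    · intro m a i y z
      induction i using Fin.lastCases with
      | last => simp only [e1, hc.add_left]
      | cast q => simp only [e2, hc.add_right]
    · intro m a i c y
      induction i using Fin.lastCases with
      | last => simp only [e1, hc.smul_left]
      | cast q => simp only [e2, hc.smul_right]

theorem rot_compat {n : ℕ} (j : Fin (n + 1)) (b : A) (x : A × (Fin n → A)) (hb : b ∈ B) :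
    cls (k := k) B (rotTuple (actRight j b x)) = cls B (rotTuple (actLeft j b x)) := by
  cases n with
  | zero => exact cls_actRight j hb x
  | succ n =>
    induction j using Fin.lastCases with
    | last =>
      have h1 : rotTuple (actRight (Fin.last (n + 1)) b x) = actRight 0 b (rotTuple x) := by
        refine Prod.ext ?_ (funext fun l => ?_)
        · simp [rotTuple, actRight]
        · refine Fin.cases ?_ (fun l => ?_) l <;> simp [rotTuple, actRight, Nat.ne_of_lt]
      have h2 : rotTuple (actLeft (Fin.last (n + 1)) b x) = actLeft 0 b (rotTuple x) := by
        refine Prod.ext ?_ (funext fun l => ?_)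
        · simp [rotTuple, actLeft]
        · refine Fin.cases ?_ (fun l => ?_) l <;> simp [rotTuple, actLeft]
          intro h
          exact absurd h (by omega)
      rw [h1, h2, cls_actRight 0 hb]
    | cast j =>
      have h1 : rotTuple (actRight j.castSucc b x) = actRight j.succ b (rotTuple x) := by
        refine Prod.ext ?_ (funext fun l => ?_)
        · simp [rotTuple, actRight]
          intro h
          exact absurd h (by omega)
        · refine Fin.cases ?_ (fun l => ?_) l <;> simp [rotTuple, actRight, eq_comm]
      have h2 : rotTuple (actLeft j.castSucc b x) = actLeft j.succ b (rotTuple x) := by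
        refine Prod.ext ?_ (funext fun l => ?_)
        · simp [rotTuple, actLeft, eq_comm]
        · refine Fin.cases ?_ (fun l => ?_) l <;> simp [rotTuple, actLeft]
          intro h
          exact absurd h (by omega)
      rw [h1, h2, cls_actRight j.succ hb]

variable (B) in
/-- The cyclic operator `tₙ` of `Zₙ(A/B) = Zₙ(A/B, A)`. -/
noncomputable def rot (n : ℕ) : Z B A n →ₗ[k] Z B A n :=
  liftZ B (fun x => cls B (rotTuple x)) isMultilin_rot fun j b x hb => rot_compat j b x hb

@[simp] theorem rot_cls {n : ℕ} (x : A × (Fin n → A)) :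
    rot B n (cls B x) = cls B (rotTuple x) := by
  simp [rot]

theorem face_succ_rotTuple {n : ℕ} (i : Fin (n + 1)) (x : A × (Fin (n + 1) → A)) :
    faceTuple i.succ (rotTuple x) = rotTuple (faceTuple i.castSucc x) := by
  refine Prod.ext ?_ (funext fun l => ?_)
  · cases n with
    | zero =>
      obtain rfl : i = 0 := Fin.ext (by omega)
      simp [rotTuple, faceTuple]
    | succ n =>
      induction i using Fin.lastCases with
      | last => simp [rotTuple, faceTuple]
      | cast i =>
        have := i.isLt
        simp [rotTuple, faceTuple]
        rw [if_neg (by omega), if_neg (by omega), if_neg (by omega)]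
  · cases n with
    | zero => exact l.elim0
    | succ n =>
      refine Fin.cases ?_ (fun l => ?_) l
      · refine Fin.cases ?_ (fun i => ?_) i <;> simp [rotTuple, faceTuple]
        intro h
        exact absurd h (by omega)
      · simp [rotTuple, faceTuple]

theorem face_zero_rotTuple {n : ℕ} (x : A × (Fin (n + 1) → A)) :
    faceTuple 0 (rotTuple x) = faceTuple (Fin.last (n + 1)) x := by
  refine Prod.ext ?_ (funext fun l => ?_)
  · simp [rotTuple, faceTuple]
  · simp [rotTuple, faceTuple]

theorem cons_rotTuple {n : ℕ} (x : A × (Fin n → A)) (i : Fin (n + 1)) :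
    (Fin.cons (rotTuple x).1 (rotTuple x).2 : Fin (n + 1) → A) i =
      (Fin.cons x.1 x.2 : Fin (n + 1) → A) (i - 1) := by
  cases n with
  | zero =>
    obtain rfl : i = 0 := Fin.ext (by omega)
    rfl
  | succ n =>
    refine Fin.cases ?_ (fun l => ?_) i
    · have : (0 : Fin (n + 2)) - 1 = (Fin.last n).succ := by
        ext
        simp
      rw [this]
      rfl
    · have : l.succ - 1 = l.castSucc := by
        rw [sub_eq_iff_eq_add]
        simp
      rw [this]
      refine Fin.cases rfl (fun l => ?_) l
      rfl

open Fin.NatCast Fin.CommRing in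
theorem rotTuple_iterate {n : ℕ} (x : A × (Fin n → A)) : rotTuple^[n + 1] x = x := by
  have key : ∀ (j : ℕ) (i : Fin (n + 1)),
      (Fin.cons (rotTuple^[j] x).1 (rotTuple^[j] x).2 : Fin (n + 1) → A) i =
        (Fin.cons x.1 x.2 : Fin (n + 1) → A) (i - (j : Fin (n + 1))) := by
    intro j
    induction j with
    | zero => simp
    | succ j ih =>
      intro i
      rw [Function.iterate_succ_apply', cons_rotTuple, ih]
      congr 1
      push_cast
      abel
  have h := fun i => key (n + 1) i
  simp only [Fin.natCast_self, sub_zero] at h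
  refine Prod.ext ?_ (funext fun i => ?_)
  · simpa using h 0
  · simpa using h i.succ

theorem rot_pow (n : ℕ) : (rot (k := k) B n) ^ (n + 1) = 1 := by
  refine hom_ext_cls fun x => ?_
  have key : ∀ j, ((rot (k := k) B n) ^ j) (cls B x) = cls B (rotTuple^[j] x) := by
    intro j
    induction j with
    | zero => simp
    | succ j ih => rw [pow_succ', Module.End.mul_apply, ih, rot_cls,
        Function.iterate_succ_apply']
  rw [key, rotTuple_iterate]
  rfl

/-! ### Differentials of the Hochschild and Tsygan complexes -/

theorem sum_comp' {ι X Y W : Type*} [AddCommGroup X] [Module k X] [AddCommGroup Y] [Module k Y]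
    [AddCommGroup W] [Module k W] (s : Finset ι) (f : ι → Y →ₗ[k] W) (g : X →ₗ[k] Y) :
    (∑ i ∈ s, f i) ∘ₗ g = ∑ i ∈ s, f i ∘ₗ g := by
  ext x
  simp [LinearMap.sum_apply]

theorem comp_sum' {ι X Y W : Type*} [AddCommGroup X] [Module k X] [AddCommGroup Y] [Module k Y]
    [AddCommGroup W] [Module k W] (s : Finset ι) (g : Y →ₗ[k] W) (f : ι → X →ₗ[k] Y) :
    g ∘ₗ (∑ i ∈ s, f i) = ∑ i ∈ s, g ∘ₗ f i := by
  ext x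
  simp [LinearMap.sum_apply, map_sum]

theorem alternating_sq {X Y W : Type*} [AddCommGroup X] [Module k X] [AddCommGroup Y] [Module k Y]
    [AddCommGroup W] [Module k W] (n : ℕ) (f : Fin n → Y →ₗ[k] W) (g : Fin (n + 1) → X →ₗ[k] Y)
    (h : ∀ i j : Fin n, i ≤ j → f i ∘ₗ g j.succ = f j ∘ₗ g i.castSucc) :
    (∑ i : Fin n, (-1 : k) ^ (i : ℕ) • f i) ∘ₗ
      (∑ j : Fin (n + 1), (-1 : k) ^ (j : ℕ) • g j) = 0 := by
  have e : (∑ i : Fin n, (-1 : k) ^ (i : ℕ) • f i) ∘ₗ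
        (∑ j : Fin (n + 1), (-1 : k) ^ (j : ℕ) • g j) =
      ∑ ij : Fin n × Fin (n + 1), (-1 : k) ^ ((ij.1 : ℕ) + ij.2) • (f ij.1 ∘ₗ g ij.2) := by
    simp only [Fintype.sum_prod_type, sum_comp', comp_sum', LinearMap.smul_comp,
      LinearMap.comp_smul, Finset.smul_sum, smul_smul, pow_add]
    rw [Finset.sum_comm]
    refine Finset.sum_congr rfl fun i _ => ?_
    refine Finset.sum_congr rfl fun j _ => ?_
    rw [mul_comm]
  rw [e, ← Finset.sum_filter_add_sum_filter_not _
    (fun ij : Fin n × Fin (n + 1) => (ij.2 : ℕ) ≤ ij.1), ← eq_neg_iff_add_eq_zero,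
    ← Finset.sum_neg_distrib]
  refine Finset.sum_bij' (fun ij h => (Fin.castLT ij.2
      (lt_of_le_of_lt (Finset.mem_filter.mp h).2 ij.1.isLt), ij.1.succ))
    (fun ij h => (ij.2.pred (by
      have := (Finset.mem_filter.mp h).2
      intro h0
      simp [h0] at this), ij.1.castSucc)) ?_ ?_ ?_ ?_ ?_
  · rintro ⟨i, j⟩ h
    simp at h ⊢
    omega
  · rintro ⟨i, j⟩ h
    simp at h ⊢
    omega
  · rintro ⟨i, j⟩ h
    simp
  · rintro ⟨i, j⟩ h
    simp
  · rintro ⟨i, j⟩ hij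
    have hij := (Finset.mem_filter.mp hij).2
    have := h (Fin.castLT j (lt_of_le_of_lt hij i.isLt)) i hij
    simp only [Fin.val_castLT, Fin.val_succ]
    rw [this, Fin.castSucc_castLT, ← neg_smul]
    congr 1
    ring

theorem face_comp_face {n : ℕ} (i j : Fin (n + 2)) (hij : i ≤ j) :
    face B M i ∘ₗ face B M j.succ = face B M j ∘ₗ face B M i.castSucc :=
  hom_ext_cls fun x => by simp [faceTuple_faceTuple i j hij]

variable (B M) in
/-- The Hochschild differential `b = ∑_{i=0}^{n+1} (-1)^i dᵢ : Zₙ₊₁ → Zₙ`. -/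
noncomputable def bMap (n : ℕ) : Z B M (n + 1) →ₗ[k] Z B M n :=
  ∑ i : Fin (n + 2), (-1 : k) ^ (i : ℕ) • face B M i

variable (B M) in
/-- The differential `b' = ∑_{i=0}^{n} (-1)^i dᵢ : Zₙ₊₁ → Zₙ`, without the last face. -/
noncomputable def bMap' (n : ℕ) : Z B M (n + 1) →ₗ[k] Z B M n :=
  ∑ i : Fin (n + 1), (-1 : k) ^ (i : ℕ) • face B M i.castSucc

theorem bMap_bMap (n : ℕ) : bMap B M n ∘ₗ bMap B M (n + 1) = 0 :=
  alternating_sq (n + 2) _ _ face_comp_face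

theorem bMap'_bMap' (n : ℕ) : bMap' B M n ∘ₗ bMap' B M (n + 1) = 0 :=
  alternating_sq (n + 1) (fun i => face B M i.castSucc) (fun j => face B M j.castSucc)
    fun i j hij => face_comp_face i.castSucc j.castSucc hij

variable (B) in
/-- The signed cyclic operator `(-1)ⁿ tₙ` on `Zₙ(A/B)`. -/
noncomputable def signedRot (n : ℕ) : Module.End k (Z B A n) := (-1 : k) ^ n • rot B n

variable (B) in
/-- The norm operator `1 + T + ⋯ + Tⁿ` on `Zₙ(A/B)`, where `T = (-1)ⁿ tₙ`. -/
noncomputable def normMap (n : ℕ) : Module.End k (Z B A n) :=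
  ∑ j ∈ Finset.range (n + 1), signedRot B n ^ j

theorem signedRot_pow (n : ℕ) : signedRot (k := k) B n ^ (n + 1) = 1 := by
  rw [signedRot, smul_pow, rot_pow, ← pow_mul, (Nat.even_mul_succ_self n).neg_one_pow, one_smul]

theorem signedRot_normMap (n : ℕ) : signedRot (k := k) B n * normMap B n = normMap B n := by
  have h := mul_geom_sum (signedRot (k := k) B n) (n + 1)
  rw [signedRot_pow, sub_self, sub_mul, one_mul, sub_eq_zero] at h
  exact h

theorem normMap_signedRot (n : ℕ) : normMap (k := k) B n * signedRot B n = normMap B n := by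
  have h := geom_sum_mul (signedRot (k := k) B n) (n + 1)
  rw [signedRot_pow, sub_self, mul_sub, mul_one, sub_eq_zero] at h
  exact h

theorem signedRot_pow_normMap (n j : ℕ) :
    signedRot (k := k) B n ^ j * normMap B n = normMap B n := by
  induction j with
  | zero => simp
  | succ j ih => rw [pow_succ, mul_assoc, signedRot_normMap, ih]

theorem normMap_signedRot_pow (n j : ℕ) :
    normMap (k := k) B n * signedRot B n ^ j = normMap B n := by
  induction j with
  | zero => simp
  | succ j ih => rw [pow_succ', ← mul_assoc, normMap_signedRot, ih]

theorem face_succ_signedRot {n : ℕ} (i : Fin (n + 1)) :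
    ((-1 : k) ^ (i.succ : ℕ) • face B A i.succ) ∘ₗ signedRot B (n + 1) =
      signedRot B n ∘ₗ ((-1 : k) ^ (i : ℕ) • face B A i.castSucc) := by
  refine hom_ext_cls fun x => ?_
  simp only [signedRot, LinearMap.comp_apply, LinearMap.smul_apply, map_smul, rot_cls, face_cls,
    face_succ_rotTuple, smul_smul, Fin.val_succ]
  congr 1
  ring

theorem face_zero_signedRot {n : ℕ} :
    face B A (0 : Fin (n + 2)) ∘ₗ signedRot B (n + 1) =
      (-1 : k) ^ (n + 1) • face B A (Fin.last (n + 1)) := by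
  refine hom_ext_cls fun x => ?_
  simp only [signedRot, LinearMap.comp_apply, LinearMap.smul_apply, map_smul, rot_cls, face_cls,
    face_zero_rotTuple]

theorem bMap_eq (n : ℕ) : bMap B M n =
    bMap' B M n + (-1 : k) ^ (n + 1) • face B M (Fin.last (n + 1)) := by
  rw [bMap, Fin.sum_univ_castSucc]
  rfl

theorem bMap_one_sub (n : ℕ) :
    bMap B A n ∘ₗ (1 - signedRot B (n + 1)) = (1 - signedRot B n) ∘ₗ bMap' (k := k) B A n := by
  have h : bMap B A n ∘ₗ signedRot B (n + 1) =
      (-1 : k) ^ (n + 1) • face B A (Fin.last (n + 1)) + signedRot B n ∘ₗ bMap' B A n := by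
    rw [bMap, Fin.sum_univ_succ, LinearMap.add_comp, sum_comp']
    simp only [face_succ_signedRot]
    rw [bMap', comp_sum']
    simp [face_zero_signedRot]
  rw [LinearMap.comp_sub, h, LinearMap.sub_comp, bMap_eq, Module.End.one_eq_id,
    Module.End.one_eq_id, LinearMap.comp_id, LinearMap.id_comp]
  abel

theorem face_signedRot_pow {n : ℕ} (i : ℕ) (hi : i < n + 2) :
    ((-1 : k) ^ i • face B A ⟨i, hi⟩) ∘ₗ (signedRot B (n + 1) ^ i) =
      (signedRot B n ^ i) ∘ₗ face B A 0 := by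
  induction i with
  | zero => simp [Module.End.one_eq_id]
  | succ i ih =>
    have h := face_succ_signedRot (k := k) (B := B) (⟨i, by omega⟩ : Fin (n + 1))
    simp only [Fin.succ_mk, Fin.castSucc_mk] at h
    rw [pow_succ' (signedRot B (n + 1)), Module.End.mul_eq_comp, ← LinearMap.comp_assoc, h,
      LinearMap.comp_assoc, ih (by omega), ← LinearMap.comp_assoc, ← Module.End.mul_eq_comp, ← pow_succ']

theorem bMap'_normMap (n : ℕ) :
    bMap' B A n ∘ₗ normMap B (n + 1) = normMap B n ∘ₗ bMap (k := k) B A n := by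
  have h1 : bMap' B A n ∘ₗ normMap B (n + 1) =
      normMap (k := k) B n ∘ₗ face B A 0 ∘ₗ normMap B (n + 1) := by
    rw [bMap', sum_comp']
    conv_rhs => rw [normMap, sum_comp', Finset.sum_range]
    refine Finset.sum_congr rfl fun i _ => ?_
    conv_lhs => rw [← signedRot_pow_normMap (n + 1) i]
    rw [Module.End.mul_eq_comp, ← LinearMap.comp_assoc, ← LinearMap.comp_assoc]
    congr 1
    exact face_signedRot_pow (i : ℕ) (by omega)
  have h2 : ∀ i : Fin (n + 2), normMap B n ∘ₗ ((-1 : k) ^ (i : ℕ) • face B A i) =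
      normMap B n ∘ₗ face B A 0 ∘ₗ signedRot B (n + 1) ^ (n + 2 - (i : ℕ)) := by
    intro i
    have e : ((-1 : k) ^ (i : ℕ) • face B A i) =
        (((-1 : k) ^ (i : ℕ) • face B A i) ∘ₗ signedRot B (n + 1) ^ (i : ℕ)) ∘ₗ
          signedRot B (n + 1) ^ (n + 2 - (i : ℕ)) := by
      rw [LinearMap.comp_assoc, ← Module.End.mul_eq_comp, ← pow_add,
        Nat.add_sub_cancel' i.isLt.le, signedRot_pow, Module.End.one_eq_id, LinearMap.comp_id]
    rw [e, face_signedRot_pow (i : ℕ) i.isLt, LinearMap.comp_assoc, ← LinearMap.comp_assoc,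
      ← Module.End.mul_eq_comp, normMap_signedRot_pow]
  rw [h1, bMap, comp_sum']
  simp only [h2]
  rw [← comp_sum', ← comp_sum']
  congr 2
  rw [Fin.sum_univ_eq_sum_range (fun i => signedRot (k := k) B (n + 1) ^ (n + 2 - i)),
    ← Finset.sum_range_reflect]
  conv_lhs => rw [← signedRot_normMap, normMap, Finset.mul_sum]
  refine Finset.sum_congr rfl fun i hi => ?_
  rw [← pow_succ']
  congr 1
  have := Finset.mem_range.1 hi
  omega

variable (B) in
/-- The vertical differential in the `p`-th column: `b` if `p` is even, `b'` if `p` is odd. -/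
noncomputable def colD (p n : ℕ) : Z B A (n + 1) →ₗ[k] Z B A n :=
  if Even p then bMap B A n else bMap' B A n

variable (B) in
/-- The horizontal differential from the column `p + 1` to the column `p`: `1 - T` if `p` is even,
`1 + T + ⋯ + Tⁿ` if `p` is odd. -/
noncomputable def rowD (p n : ℕ) : Z B A n →ₗ[k] Z B A n :=
  if Even p then 1 - signedRot B n else normMap B n

theorem colD_colD (p n : ℕ) : colD (k := k) B p n ∘ₗ colD B p (n + 1) = 0 := by
  unfold colD
  split_ifs
  exacts [bMap_bMap n, bMap'_bMap' n]

theorem rowD_rowD (p n : ℕ) : rowD (k := k) B p n ∘ₗ rowD B (p + 1) n = 0 := by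
  unfold rowD
  by_cases hp : Even p
  · rw [if_pos hp, if_neg (Nat.not_even_iff_odd.2 hp.add_one), ← Module.End.mul_eq_comp, sub_mul,
      one_mul, signedRot_normMap, sub_self]
  · rw [if_neg hp, if_pos (Nat.not_even_iff_odd.1 hp).add_one, ← Module.End.mul_eq_comp, mul_sub,
      mul_one, normMap_signedRot, sub_self]

theorem colD_rowD (p n : ℕ) :
    colD (k := k) B p n ∘ₗ rowD B p (n + 1) = rowD B p n ∘ₗ colD B (p + 1) n := by
  unfold colD rowD
  by_cases hp : Even p
  · rw [if_pos hp, if_pos hp, if_pos hp, if_neg (Nat.not_even_iff_odd.2 hp.add_one)]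
    exact bMap_one_sub n
  · rw [if_neg hp, if_neg hp, if_neg hp, if_pos (Nat.not_even_iff_odd.1 hp).add_one]
    exact bMap'_normMap n

/-! ### The complexes and their homology -/

variable (B M) in
/-- The Hochschild complex `C_*(A/B, M)`. -/
noncomputable def hochschildComplex : ChainComplex (ModuleCat.{max u v w} k) ℕ :=
  ChainComplex.of (fun n => ModuleCat.of k (Z B M n)) (fun n => ModuleCat.ofHom (bMap B M n))
    fun n => by
      rw [← ModuleCat.ofHom_comp, bMap_bMap]
      rfl

variable (B M) in
/-- The Hochschild homology `HHₙ(A/B, M)` of the extension `A/B` with coefficients in `M`. -/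
noncomputable def HH (n : ℕ) : ModuleCat.{max u v w} k := (hochschildComplex B M).homology n

variable (B) in
/-- The `p`-th column, before the signs of the total complex are introduced. -/
noncomputable def column (p : ℕ) : ChainComplex (ModuleCat.{max u v} k) ℕ :=
  ChainComplex.of (fun n => ModuleCat.of k (Z B A n)) (fun n => ModuleCat.ofHom (colD B p n))
    fun n => by
      rw [← ModuleCat.ofHom_comp, colD_colD]
      rfl

variable (B) in
/-- The horizontal differential of the double complex, as a morphism of columns. -/
noncomputable def columnHom (p : ℕ) : column (k := k) B (p + 1) ⟶ column B p :=
  ChainComplex.ofHom (fun n => ModuleCat.ofHom (rowD B p n)) fun n => by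
    simp only [column, ChainComplex.of_d]
    rw [← ModuleCat.ofHom_comp, ← ModuleCat.ofHom_comp, colD_rowD]

variable (B) in
/-- The Tsygan double complex `CC_{**}(A/B)`. Mathlib's convention is that the squares commute and
that the total complex multiplies the vertical differential of the `p`-th column by `(-1)^p`; so
the columns of even degree of the anti-commutative double complex are `C_*(A/B)`, those of odd
degree have the differential `-b'`, and the rows are `1 - T`, `1 + T + ⋯ + Tⁿ`, with
`T = (-1)ⁿ tₙ`. -/
noncomputable def tsyganComplex :
    HomologicalComplex₂ (ModuleCat.{max u v} k) (ComplexShape.down ℕ) (ComplexShape.down ℕ) :=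
  ChainComplex.of (column B) (columnHom B) fun p => by
    ext n : 1
    change ModuleCat.ofHom (rowD B (p + 1) n) ≫ ModuleCat.ofHom (rowD B p n) = 0
    rw [← ModuleCat.ofHom_comp, rowD_rowD]
    rfl

variable (B) in
/-- The total complex of the Tsygan double complex. -/
noncomputable def cyclicComplex : ChainComplex (ModuleCat.{max u v} k) ℕ :=
  (tsyganComplex (k := k) B).total (ComplexShape.down ℕ)

variable (B) in
/-- The cyclic homology `HCₙ(A/B)` of the extension `A/B`. -/
noncomputable def HC (n : ℕ) : ModuleCat.{max u v} k := (cyclicComplex (k := k) B).homology n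

/-! ### The canonical maps for subalgebras `C ≤ B` -/

variable {C : Subalgebra k A}

theorem relations_mono (h : C ≤ B) (n : ℕ) : relations C M n ≤ relations B M n :=
  Submodule.span_mono fun _ ⟨j, b, x, hb, e⟩ => ⟨j, b, x, h hb, e⟩

variable (M) in
/-- The canonical projection `Zₙ(A/C, M) → Zₙ(A/B, M)`. -/
noncomputable def projMap (h : C ≤ B) (n : ℕ) : Z C M n →ₗ[k] Z B M n :=
  Submodule.factor (relations_mono h n)

@[simp] theorem projMap_cls (h : C ≤ B) {n : ℕ} (x : M × (Fin n → A)) :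
    projMap M h n (cls C x) = cls B x := rfl

theorem face_projMap (h : C ≤ B) {n : ℕ} (i : Fin (n + 2)) :
    face B M i ∘ₗ projMap M h (n + 1) = projMap M h n ∘ₗ face C M i :=
  hom_ext_cls fun x => by simp

theorem bMap_projMap (h : C ≤ B) (n : ℕ) :
    bMap B M n ∘ₗ projMap M h (n + 1) = projMap M h n ∘ₗ bMap C M n := by
  simp only [bMap, sum_comp', comp_sum', LinearMap.smul_comp,
    LinearMap.comp_smul, face_projMap]

theorem bMap'_projMap (h : C ≤ B) (n : ℕ) :
    bMap' B M n ∘ₗ projMap M h (n + 1) = projMap M h n ∘ₗ bMap' C M n := by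
  simp only [bMap', sum_comp', comp_sum', LinearMap.smul_comp,
    LinearMap.comp_smul, face_projMap]

theorem signedRot_projMap (h : C ≤ B) (n : ℕ) :
    signedRot B n ∘ₗ projMap A h n = projMap A h n ∘ₗ signedRot C n :=
  hom_ext_cls fun x => by simp [signedRot]

theorem normMap_projMap (h : C ≤ B) (n : ℕ) :
    normMap B n ∘ₗ projMap A h n = projMap A h n ∘ₗ normMap C n := by
  have key : ∀ j : ℕ, (signedRot B n ^ j) ∘ₗ projMap A h n =
      projMap A h n ∘ₗ (signedRot C n ^ j) := by
    intro j
    induction j with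
    | zero => simp [Module.End.one_eq_id]
    | succ j ih => rw [pow_succ, pow_succ, Module.End.mul_eq_comp, Module.End.mul_eq_comp,
        LinearMap.comp_assoc, signedRot_projMap, ← LinearMap.comp_assoc, ih, LinearMap.comp_assoc]
  simp only [normMap, sum_comp', comp_sum', key]

theorem colD_projMap (h : C ≤ B) (p n : ℕ) :
    colD B p n ∘ₗ projMap A h (n + 1) = projMap A h n ∘ₗ colD C p n := by
  unfold colD
  split_ifs
  exacts [bMap_projMap h n, bMap'_projMap h n]

theorem rowD_projMap (h : C ≤ B) (p n : ℕ) :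
    rowD B p n ∘ₗ projMap A h n = projMap A h n ∘ₗ rowD C p n := by
  unfold rowD
  split_ifs
  · rw [LinearMap.sub_comp, LinearMap.comp_sub, signedRot_projMap, Module.End.one_eq_id,
      Module.End.one_eq_id, LinearMap.id_comp, LinearMap.comp_id]
  · exact normMap_projMap h n

variable (M) in
/-- The canonical map `C_*(A/C, M) → C_*(A/B, M)`. -/
noncomputable def hochschildComplexMap (h : C ≤ B) :
    hochschildComplex C M ⟶ hochschildComplex B M :=
  ChainComplex.ofHom (fun n => ModuleCat.ofHom (projMap M h n)) fun n => by
    simp only [hochschildComplex, ChainComplex.of_d]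
    rw [← ModuleCat.ofHom_comp, ← ModuleCat.ofHom_comp, bMap_projMap]

variable (M) in
/-- The canonical map `HHₙ(A/C, M) → HHₙ(A/B, M)`. -/
noncomputable def HHMap (h : C ≤ B) (n : ℕ) : HH C M n ⟶ HH B M n :=
  HomologicalComplex.homologyMap (hochschildComplexMap M h) n

/-- The canonical map between the `p`-th columns. -/
noncomputable def columnMap (h : C ≤ B) (p : ℕ) : column C p ⟶ column B p :=
  ChainComplex.ofHom (fun n => ModuleCat.ofHom (projMap A h n)) fun n => by
    simp only [column, ChainComplex.of_d]
    rw [← ModuleCat.ofHom_comp, ← ModuleCat.ofHom_comp, colD_projMap]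

/-- The canonical map `CC_{**}(A/C) → CC_{**}(A/B)`. -/
noncomputable def tsyganComplexMap (h : C ≤ B) : tsyganComplex C ⟶ tsyganComplex B :=
  ChainComplex.ofHom (columnMap h) fun p => by
    simp only [tsyganComplex, ChainComplex.of_d]
    ext n : 1
    change ModuleCat.ofHom (projMap A h n) ≫ ModuleCat.ofHom (rowD B p n) =
      ModuleCat.ofHom (rowD C p n) ≫ ModuleCat.ofHom (projMap A h n)
    rw [← ModuleCat.ofHom_comp, ← ModuleCat.ofHom_comp, rowD_projMap]

/-- The canonical map `HCₙ(A/C) → HCₙ(A/B)`. -/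
noncomputable def HCMap (h : C ≤ B) (n : ℕ) : HC C n ⟶ HC B n :=
  HomologicalComplex.homologyMap
    (HomologicalComplex₂.total.map (tsyganComplexMap h) (ComplexShape.down ℕ)) n

end Chains
end RelCyclic

/-! Separability of `B` gives an idempotent e = Σ p₁ ⊗ p₂ in B ⊗ B with Σ p₁p₂ = 1 and be = eb for
all b in `B`. Think of (m, a₁, …, aₙ) as n + 1 slots on a circle, with a junction j between slot j
and the next one. Inserting e at a junction replaces its neighbours (x, y) by Σ (x p₁, p₂ y); call
this operator J_j. Because be = eb, J_j cannot tell (xb, y) from (x, by). Hence the product `avg` =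
J₀⋯Jₙ on Zₙ(A/k, M) vanishes on the relations defining Zₙ(A/B, M) and induces `expand` : Zₙ(A/B, M)
→ Zₙ(A/k, M).

Because Σ p₁p₂ = 1, the insertions become invisible in Zₙ(A/B, M), so `expand` is a section of the
projection (`projMap_expand`). For the same reason a face absorbs the insertion at the junction it
closes, while rotation permutes the junctions cyclically. So `expand` commutes with all faces and
with the cyclic operator, hence with b, b' and the rows of the Tsygan complex.

It remains to compare `avg` with the identity on Zₙ(A/k, M). Put h_j = J₀⋯J_j s_j, where s_j inserts
1 just after slot j. Then d_j h_j = J₀⋯J_{j-1} and d_{j+1} h_j = J₀⋯J_j, and the other composites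
follow the pattern of a simplicial homotopy, so the alternating sum of the h_j is a homotopy from 1
to `avg` for b (`bMap_homotopyHom_succ`). This settles Hochschild homology and the even columns. For
b' the complex of A/k is contractible by inserting 1 at the end, and composing with 1 - `avg` gives
the homotopy needed on the odd columns.

These column homotopies need not respect the horizontal maps. On the total complex, the
null-homotopic map they generate differs from the map induced by the idempotent φ = 1 - `avg` by
terms that lower the column index. In each degree that difference is nilpotent, so on homology the
map induced by φ is both nilpotent and idempotent, hence zero (`homologyMap_total_map_eq_zero`). -/

namespace RelCyclic

/-! ### Column homotopies and the total complex of a first quadrant double complex. -/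

section Total

open CategoryTheory.Limits CategoryTheory.Preadditive HomologicalComplex₂

variable {C : Type*} [Category* C] [Preadditive C]
  (K : HomologicalComplex₂ C (ComplexShape.down ℕ) (ComplexShape.down ℕ))
  [K.HasTotal (ComplexShape.down ℕ)]

theorem d₁_zero_left (q n : ℕ) : K.d₁ (ComplexShape.down ℕ) 0 q n = 0 :=
  K.d₁_eq_zero _ _ _ _ (by simp)

theorem d₂_zero_right (p n : ℕ) : K.d₂ (ComplexShape.down ℕ) p 0 n = 0 :=
  K.d₂_eq_zero _ _ _ _ (by simp)

theorem d₁_succ_left (p q n : ℕ) : K.d₁ (ComplexShape.down ℕ) (p + 1) q n =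
    (K.d (p + 1) p).f q ≫ K.ιTotalOrZero (ComplexShape.down ℕ) p q n := by
  rw [K.d₁_eq' (ComplexShape.down ℕ) (i₁ := p + 1) (i₁' := p) (by simp)]
  exact one_smul _ _

theorem d₂_succ_right (p q n : ℕ) : K.d₂ (ComplexShape.down ℕ) p (q + 1) n =
    (-1 : ℤˣ) ^ p • ((K.X p).d (q + 1) q ≫ K.ιTotalOrZero (ComplexShape.down ℕ) p q n) := by
  rw [K.d₂_eq' (ComplexShape.down ℕ) p (i₂ := q + 1) (i₂' := q) (by simp)]
  rfl

variable {K}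

/-- The map on the total complex given by vertical maps `h` raising the degree by one, with the
sign of the vertical differential. -/
noncomputable def totalHom (h : ∀ p q : ℕ, (K.X p).X q ⟶ (K.X p).X (q + 1)) (n m : ℕ) :
    (K.total (ComplexShape.down ℕ)).X n ⟶ (K.total (ComplexShape.down ℕ)).X m :=
  K.totalDesc fun p q _ => (-1 : ℤˣ) ^ p • (h p q ≫ K.ιTotalOrZero (ComplexShape.down ℕ) p (q + 1) m)

theorem ι_totalHom (h : ∀ p q : ℕ, (K.X p).X q ⟶ (K.X p).X (q + 1)) (n m p q : ℕ)
    (e : p + q = n) :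
    K.ιTotal (ComplexShape.down ℕ) p q n e ≫ totalHom h n m =
      (-1 : ℤˣ) ^ p • (h p q ≫ K.ιTotalOrZero (ComplexShape.down ℕ) p (q + 1) m) := by
  unfold totalHom
  exact K.ι_totalDesc _ _ _ _

theorem ιTotal_totalHom_d_zero_left (h : ∀ p q : ℕ, (K.X p).X q ⟶ (K.X p).X (q + 1))
    (n q : ℕ) (e : 0 + q = n) :
    K.ιTotal (ComplexShape.down ℕ) 0 q n e ≫ totalHom h n (n + 1) ≫
      (K.total (ComplexShape.down ℕ)).d (n + 1) n =
      (h 0 q ≫ (K.X 0).d (q + 1) q) ≫ K.ιTotal (ComplexShape.down ℕ) 0 q n e := by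
  rw [← Category.assoc, ι_totalHom, K.ιTotalOrZero_eq (ComplexShape.down ℕ) 0 (q + 1) (n + 1)
    (by subst e; exact (Nat.add_assoc _ _ _).symm), pow_zero, one_smul, Category.assoc,
    total_d, comp_add, K.ι_D₁, K.ι_D₂, d₁_zero_left, d₂_succ_right, pow_zero, one_smul, zero_add,
    K.ιTotalOrZero_eq (ComplexShape.down ℕ) 0 q n e, Category.assoc]

theorem ιTotal_totalHom_d_succ_left (h : ∀ p q : ℕ, (K.X p).X q ⟶ (K.X p).X (q + 1))
    (n p q : ℕ) (e : p + 1 + q = n) :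
    K.ιTotal (ComplexShape.down ℕ) (p + 1) q n e ≫ totalHom h n (n + 1) ≫
      (K.total (ComplexShape.down ℕ)).d (n + 1) n =
      ((-1 : ℤˣ) ^ (p + 1) • (h (p + 1) q ≫ (K.d (p + 1) p).f (q + 1))) ≫
        K.ιTotal (ComplexShape.down ℕ) p (q + 1) n (by rw [← e]; exact Nat.add_right_comm p q 1) +
      (h (p + 1) q ≫ (K.X (p + 1)).d (q + 1) q) ≫
        K.ιTotal (ComplexShape.down ℕ) (p + 1) q n e := by
  rw [← Category.assoc, ι_totalHom, K.ιTotalOrZero_eq (ComplexShape.down ℕ) (p + 1) (q + 1) (n + 1)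
    (by subst e; exact (Nat.add_assoc _ _ _).symm), Linear.units_smul_comp, Category.assoc,
    total_d, comp_add, K.ι_D₁, K.ι_D₂, d₁_succ_left, d₂_succ_right,
    K.ιTotalOrZero_eq (ComplexShape.down ℕ) (p + 1) q n e,
    K.ιTotalOrZero_eq (ComplexShape.down ℕ) p (q + 1) n
      (by rw [← e]; exact Nat.add_right_comm p q 1), comp_add, smul_add,
    Linear.comp_units_smul, smul_smul, Int.units_mul_self, one_smul, Linear.units_smul_comp,
    Category.assoc, Category.assoc]

/-- Only the column in which this term lands matters later, so the morphism `g` is left unspecified.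
-/
theorem ιTotal_zero_right_d (n p : ℕ) (e : p + 1 + 0 = n + 1)
    (h : ∀ p q : ℕ, (K.X p).X q ⟶ (K.X p).X (q + 1)) :
    ∃ g, K.ιTotal (ComplexShape.down ℕ) (p + 1) 0 (n + 1) e ≫
        (K.total (ComplexShape.down ℕ)).d (n + 1) n ≫ totalHom h n (n + 1) =
      g ≫ K.ιTotalOrZero (ComplexShape.down ℕ) p 1 (n + 1) := by
  obtain rfl : n = p := (Nat.succ_injective e).symm
  refine ⟨(-1 : ℤˣ) ^ n • ((K.d (n + 1) n).f 0 ≫ h n 0), ?_⟩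
  rw [← Category.assoc, total_d, comp_add, K.ι_D₁, K.ι_D₂, d₁_succ_left, d₂_zero_right, add_zero,
    K.ιTotalOrZero_eq (ComplexShape.down ℕ) n 0 n rfl, Category.assoc, ι_totalHom,
    Linear.comp_units_smul, Linear.units_smul_comp, Category.assoc]

theorem ιTotal_zero_left_succ_right_d (n q : ℕ) (e : 0 + (q + 1) = n + 1)
    (h : ∀ p q : ℕ, (K.X p).X q ⟶ (K.X p).X (q + 1)) :
    K.ιTotal (ComplexShape.down ℕ) 0 (q + 1) (n + 1) e ≫
        (K.total (ComplexShape.down ℕ)).d (n + 1) n ≫ totalHom h n (n + 1) =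
      ((K.X 0).d (q + 1) q ≫ h 0 q) ≫ K.ιTotal (ComplexShape.down ℕ) 0 (q + 1) (n + 1) e := by
  rw [← Category.assoc, total_d, comp_add, K.ι_D₁, K.ι_D₂, d₁_zero_left, d₂_succ_right, zero_add,
    K.ιTotalOrZero_eq (ComplexShape.down ℕ) 0 q n (by change 0 + q = n; omega), pow_zero, one_smul,
    Category.assoc, ι_totalHom, K.ιTotalOrZero_eq (ComplexShape.down ℕ) 0 (q + 1) (n + 1) e,
    pow_zero, one_smul, Category.assoc]

theorem ιTotal_succ_left_succ_right_d (n p q : ℕ) (e : p + 1 + (q + 1) = n + 1)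
    (h : ∀ p q : ℕ, (K.X p).X q ⟶ (K.X p).X (q + 1)) :
    ∃ g, K.ιTotal (ComplexShape.down ℕ) (p + 1) (q + 1) (n + 1) e ≫
        (K.total (ComplexShape.down ℕ)).d (n + 1) n ≫ totalHom h n (n + 1) =
      g ≫ K.ιTotalOrZero (ComplexShape.down ℕ) p (q + 2) (n + 1) +
      ((K.X (p + 1)).d (q + 1) q ≫ h (p + 1) q) ≫
        K.ιTotal (ComplexShape.down ℕ) (p + 1) (q + 1) (n + 1) e := by
  refine ⟨(-1 : ℤˣ) ^ p • ((K.d (p + 1) p).f (q + 1) ≫ h p (q + 1)), ?_⟩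
  rw [← Category.assoc, total_d, comp_add, K.ι_D₁, K.ι_D₂, d₁_succ_left, d₂_succ_right,
    K.ιTotalOrZero_eq (ComplexShape.down ℕ) p (q + 1) n (by change p + (q + 1) = n; omega),
    K.ιTotalOrZero_eq (ComplexShape.down ℕ) (p + 1) q n (by change p + 1 + q = n; omega),
    add_comp, Linear.units_smul_comp, Category.assoc, Category.assoc, ι_totalHom, ι_totalHom,
    Linear.comp_units_smul, Linear.comp_units_smul, smul_smul, Int.units_mul_self, one_smul,
    K.ιTotalOrZero_eq (ComplexShape.down ℕ) (p + 1) (q + 1) (n + 1) e, Linear.units_smul_comp,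
    Category.assoc, Category.assoc]

variable {φ : K ⟶ K} (H : ∀ p, Homotopy (φ.f p) 0)

/-- The endomorphism of the total complex homotopic to zero which is induced by homotopies on the
columns. -/
noncomputable def totalNull :
    K.total (ComplexShape.down ℕ) ⟶ K.total (ComplexShape.down ℕ) :=
  Homotopy.nullHomotopicMap' fun n m _ => totalHom (fun p q => (H p).hom q (q + 1)) n m

theorem homotopy_zero_f_zero {X Y : ChainComplex C ℕ} {f : X ⟶ Y} (h : Homotopy f 0) :
    f.f 0 = h.hom 0 1 ≫ Y.d 1 0 := by
  rw [h.comm 0, dNext_eq_zero _ _ (by simp), prevD_eq (j' := 1) (w := by simp)]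
  simp

theorem homotopy_zero_f_succ {X Y : ChainComplex C ℕ} {f : X ⟶ Y} (h : Homotopy f 0) (n : ℕ) :
    f.f (n + 1) = X.d (n + 1) n ≫ h.hom n (n + 1) +
      h.hom (n + 1) (n + 2) ≫ Y.d (n + 2) (n + 1) := by
  rw [h.comm (n + 1), dNext_eq (i' := n) (w := by simp), prevD_eq (j' := n + 2) (w := by simp)]
  simp

theorem totalNull_f_zero : (totalNull H).f 0 =
    totalHom (fun p q => (H p).hom q (q + 1)) 0 1 ≫ (K.total (ComplexShape.down ℕ)).d 1 0 :=
  Homotopy.nullHomotopicMap'_f_of_not_rel_left (by simp) (by simp) _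

theorem totalNull_f_succ (n : ℕ) : (totalNull H).f (n + 1) =
    (K.total (ComplexShape.down ℕ)).d (n + 1) n ≫
        totalHom (fun p q => (H p).hom q (q + 1)) n (n + 1) +
      totalHom (fun p q => (H p).hom q (q + 1)) (n + 1) (n + 2) ≫
        (K.total (ComplexShape.down ℕ)).d (n + 2) (n + 1) :=
  Homotopy.nullHomotopicMap'_f (by simp) (by simp) _

theorem ιTotal_totalNull_zero_left (n q : ℕ) (e : 0 + q = n) :
    K.ιTotal (ComplexShape.down ℕ) 0 q n e ≫ (totalNull H).f n =
      (φ.f 0).f q ≫ K.ιTotal (ComplexShape.down ℕ) 0 q n e := by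
  cases n with
  | zero =>
    obtain rfl : q = 0 := by omega
    rw [totalNull_f_zero, ιTotal_totalHom_d_zero_left, homotopy_zero_f_zero (H 0)]
  | succ n =>
    obtain _ | q := q
    · omega
    rw [totalNull_f_succ, comp_add, ιTotal_totalHom_d_zero_left, ιTotal_zero_left_succ_right_d,
      homotopy_zero_f_succ (H 0), add_comp]

/-- The two signs (-1)^(p+1), of the homotopy and of the vertical differential, cancel, so the
vertical part reproduces `φ`. The term with `g` gathers the horizontal differential taken before and
after the homotopy, and lies one column lower. -/
theorem ιTotal_totalNull_succ_left (n p q : ℕ) (e : p + 1 + q = n) :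
    ∃ g, K.ιTotal (ComplexShape.down ℕ) (p + 1) q n e ≫ (totalNull H).f n =
      g ≫ K.ιTotalOrZero (ComplexShape.down ℕ) p (q + 1) n +
        (φ.f (p + 1)).f q ≫ K.ιTotal (ComplexShape.down ℕ) (p + 1) q n e := by
  obtain _ | n := n
  · omega
  obtain _ | q := q
  · obtain ⟨g, hg⟩ := ιTotal_zero_right_d n p e fun p q => (H p).hom q (q + 1)
    refine ⟨g + (-1 : ℤˣ) ^ (p + 1) • ((H (p + 1)).hom 0 1 ≫ (K.d (p + 1) p).f 1), ?_⟩
    rw [totalNull_f_succ, comp_add, hg, ιTotal_totalHom_d_succ_left, homotopy_zero_f_zero (H _),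
      ← add_assoc, add_comp, ← K.ιTotalOrZero_eq]
  · obtain ⟨g, hg⟩ := ιTotal_succ_left_succ_right_d n p q e fun p q => (H p).hom q (q + 1)
    refine ⟨g + (-1 : ℤˣ) ^ (p + 1) •
      ((H (p + 1)).hom (q + 1) (q + 2) ≫ (K.d (p + 1) p).f (q + 2)), ?_⟩
    rw [totalNull_f_succ, comp_add, hg, ιTotal_totalHom_d_succ_left, homotopy_zero_f_succ (H _),
      ← K.ιTotalOrZero_eq (ComplexShape.down ℕ) p (q + 1 + 1), add_comp, add_comp]
    abel

/-- The defect of `totalNull H` from `φ` lowers the horizontal degree. -/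
theorem ιTotal_defect_pow (n j : ℕ) : ∀ (p q : ℕ) (e : p + q = n), p < j →
    K.ιTotal (ComplexShape.down ℕ) p q n e ≫ HomologicalComplex.Hom.f
      ((show End (K.total (ComplexShape.down ℕ)) from
        (totalNull H - total.map φ (ComplexShape.down ℕ))) ^ j :) n = 0 := by
  induction j with
  | zero => intro p q e h; omega
  | succ j ih =>
    intro p q e h
    -- Multiplication in `End` is composition in reverse order, so this peels off the defect that is
    -- applied first; the induction hypothesis then acts one column lower.
    rw [pow_succ, End.mul_def, HomologicalComplex.comp_f, HomologicalComplex.sub_f_apply,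
      ← Category.assoc, comp_sub, ιTotal_map]
    obtain _ | p := p
    · rw [ιTotal_totalNull_zero_left, sub_self, zero_comp]
    · obtain ⟨g, hg⟩ := ιTotal_totalNull_succ_left H n p q e
      rw [hg, add_sub_cancel_right, Category.assoc,
        K.ιTotalOrZero_eq (ComplexShape.down ℕ) p (q + 1) n (by change p + (q + 1) = n; omega),
        ih _ _ _ (by omega), comp_zero]

theorem homologyMap_eq_zero_of_f_eq_zero {X Y : ChainComplex C ℕ} (f : X ⟶ Y) (n : ℕ)
    [X.HasHomology n] [Y.HasHomology n] (h : f.f n = 0) :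
    HomologicalComplex.homologyMap f n = 0 := by
  rw [← cancel_epi (X.homologyπ n), HomologicalComplex.homologyπ_naturality]
  have : HomologicalComplex.cyclesMap f n = 0 := by
    rw [← cancel_mono (Y.iCycles n), HomologicalComplex.cyclesMap_i, h]
    simp
  rw [this, zero_comp, comp_zero]

/-- An idempotent endomorphism of a first quadrant double complex that is homotopic to zero on every
column induces zero on the homology of the total complex. -/
theorem homologyMap_total_map_eq_zero (H : ∀ p, Homotopy (φ.f p) 0) (hφ : φ ≫ φ = φ) (n : ℕ)
    [(K.total (ComplexShape.down ℕ)).HasHomology n] :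
    HomologicalComplex.homologyMap (total.map φ (ComplexShape.down ℕ)) n = 0 := by
  let F : End (K.total (ComplexShape.down ℕ)) →* End ((K.total (ComplexShape.down ℕ)).homology n) :=
    { toFun := fun f => HomologicalComplex.homologyMap f n
      map_one' := HomologicalComplex.homologyMap_id _ _
      map_mul' := fun f g => HomologicalComplex.homologyMap_comp _ _ _ }
  set ψ : End (K.total (ComplexShape.down ℕ)) := totalNull H - total.map φ (ComplexShape.down ℕ)
    with hψ
  have h1 : F ψ = - F (total.map φ (ComplexShape.down ℕ)) := by
    change HomologicalComplex.homologyMap (totalNull H - total.map φ (ComplexShape.down ℕ)) n = _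
    rw [HomologicalComplex.homologyMap_sub, totalNull,
      (Homotopy.nullHomotopy' _).homologyMap_eq, HomologicalComplex.homologyMap_zero, zero_sub]
    rfl
  -- Degree n meets only the columns 0, …, n, so n + 1 drops exhaust them.
  have h2 : F ψ ^ (n + 1) = 0 := by
    rw [← map_pow]
    refine homologyMap_eq_zero_of_f_eq_zero _ n ?_
    ext p q e
    rw [comp_zero]
    exact ιTotal_defect_pow H n (n + 1) p q e (Nat.lt_succ_of_le (by
      change p + q = n at e; omega))
  have h3 : IsIdempotentElem (F (total.map φ (ComplexShape.down ℕ))) := by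
    rw [IsIdempotentElem, ← map_mul, End.mul_def, ← total.map_comp, hφ]
  -- Every positive power of an idempotent is the idempotent itself, so nilpotence makes it zero up
  -- to a sign.
  rw [h1, neg_pow, h3.pow_succ_eq] at h2
  have h4 := congrArg (fun x => (-1) ^ (n + 1) * x) h2
  change F (total.map φ (ComplexShape.down ℕ)) = 0
  simpa only [← mul_assoc, ← pow_add, Even.neg_one_pow ⟨n + 1, rfl⟩, one_mul, mul_zero] using h4

end Total

section TotalIso

open CategoryTheory.Limits HomologicalComplex₂

/-- A split epimorphism of first quadrant double complexes with a section that is a homotopy inverse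
on every column induces isomorphisms on the homology of the total complexes. -/
theorem isIso_homologyMap_total_map {C : Type*} [Category* C] [Preadditive C]
    {K L : HomologicalComplex₂ C (ComplexShape.down ℕ) (ComplexShape.down ℕ)}
    [K.HasTotal (ComplexShape.down ℕ)] [L.HasTotal (ComplexShape.down ℕ)] (r : K ⟶ L) (s : L ⟶ K)
    (hs : s ≫ r = 𝟙 L) (H : ∀ p, Homotopy ((𝟙 K - r ≫ s).f p) 0) (n : ℕ)
    [(K.total (ComplexShape.down ℕ)).HasHomology n]
    [(L.total (ComplexShape.down ℕ)).HasHomology n] :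
    IsIso (HomologicalComplex.homologyMap (total.map r (ComplexShape.down ℕ)) n) := by
  refine ⟨HomologicalComplex.homologyMap (total.map s (ComplexShape.down ℕ)) n, ?_, ?_⟩
  -- The relation `s ≫ r = 𝟙` makes `r ≫ s` idempotent, hence also its complement.
  · have h := homologyMap_total_map_eq_zero H (by
      simp [Preadditive.sub_comp, Preadditive.comp_sub, reassoc_of% hs]) n
    have e : total.map (𝟙 K - r ≫ s) (ComplexShape.down ℕ) =
        𝟙 _ - total.map r (ComplexShape.down ℕ) ≫ total.map s (ComplexShape.down ℕ) := by
      rw [← total.map_comp]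
      ext m p q e
      simp [Preadditive.sub_comp, Preadditive.comp_sub]
    rw [e, HomologicalComplex.homologyMap_sub, HomologicalComplex.homologyMap_id,
      HomologicalComplex.homologyMap_comp, sub_eq_zero] at h
    exact h.symm
  · rw [← HomologicalComplex.homologyMap_comp, ← total.map_comp, hs, total.map_id,
      HomologicalComplex.homologyMap_id]

end TotalIso

set_option linter.unusedSectionVars false
set_option linter.unreachableTactic false
set_option linter.unusedTactic false
set_option linter.flexible false
set_option linter.unnecessarySimpa false
set_option linter.unusedSimpArgs false

/-! ### Identities between faces, degeneracies, slot multiplications and rotation on tuples. -/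

section TupleLemmas

variable {A : Type v} {M : Type w} [Ring A] [AddCommGroup M] [Module A M] [Module Aᵐᵒᵖ M]

theorem actRight_zero {n : ℕ} (b : A) (x : M × (Fin n → A)) :
    actRight 0 b x = (op b • x.1, x.2) := by
  simp [actRight]

theorem actRight_succ {n : ℕ} (i : Fin n) (b : A) (x : M × (Fin n → A)) :
    actRight i.succ b x = (x.1, Function.update x.2 i (x.2 i * b)) := by
  refine Prod.ext (by simp [actRight]) (funext fun l => ?_)
  by_cases h : l = i
  · subst h; simp [actRight]
  · simp [actRight, h, Fin.val_inj]

theorem actLeft_last {n : ℕ} (b : A) (x : M × (Fin n → A)) :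
    actLeft (Fin.last n) b x = (b • x.1, x.2) := by
  refine Prod.ext (by simp [actLeft]) (funext fun l => ?_)
  simp [actLeft, l.isLt.ne]

theorem actLeft_castSucc {n : ℕ} (i : Fin n) (b : A) (x : M × (Fin n → A)) :
    actLeft i.castSucc b x = (x.1, Function.update x.2 i (b * x.2 i)) := by
  refine Prod.ext (by simp [actLeft, i.isLt.ne]) (funext fun l => ?_)
  by_cases h : l = i
  · subst h; simp [actLeft]
  · simp [actLeft, h, Fin.val_inj]

theorem actRight_one {n : ℕ} (j : Fin (n + 1)) (x : M × (Fin n → A)) : actRight j 1 x = x := by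
  simp [actRight]

theorem actLeft_one {n : ℕ} (j : Fin (n + 1)) (x : M × (Fin n → A)) : actLeft j 1 x = x := by
  simp [actLeft]

theorem actRight_actRight {n : ℕ} (j : Fin (n + 1)) (b c : A) (x : M × (Fin n → A)) :
    actRight j b (actRight j c x) = actRight j (c * b) x := by
  refine Prod.ext ?_ (funext fun l => ?_) <;> simp only [actRight] <;> split_ifs <;>
    simp [smul_smul, mul_assoc]

theorem actLeft_actLeft {n : ℕ} (j : Fin (n + 1)) (b c : A) (x : M × (Fin n → A)) :
    actLeft j b (actLeft j c x) = actLeft j (b * c) x := by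
  refine Prod.ext ?_ (funext fun l => ?_) <;> simp only [actLeft] <;> split_ifs <;>
    simp [smul_smul, mul_assoc]

theorem actRight_comm {n : ℕ} {i j : Fin (n + 1)} (h : i ≠ j) (b c : A) (x : M × (Fin n → A)) :
    actRight i b (actRight j c x) = actRight j c (actRight i b x) := by
  rw [Ne, Fin.ext_iff] at h
  refine Prod.ext ?_ (funext fun l => ?_) <;> simp only [actRight] <;> split_ifs <;>
    first | rfl | omega

theorem actLeft_comm {n : ℕ} {i j : Fin (n + 1)} (h : i ≠ j) (b c : A) (x : M × (Fin n → A)) :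
    actLeft i b (actLeft j c x) = actLeft j c (actLeft i b x) := by
  rw [Ne, Fin.ext_iff] at h
  refine Prod.ext ?_ (funext fun l => ?_) <;> simp only [actLeft] <;> split_ifs <;>
    first | rfl | omega

/-- No condition on `i` and `j` is needed: when both operations hit the same slot, they act on its
two sides, and associativity of `A` or the bimodule axiom of `M` applies. -/
theorem actRight_actLeft [SMulCommClass A Aᵐᵒᵖ M] {n : ℕ} (i j : Fin (n + 1)) (b c : A)
    (x : M × (Fin n → A)) :
    actRight i b (actLeft j c x) = actLeft j c (actRight i b x) := by
  refine Prod.ext ?_ (funext fun l => ?_) <;> simp only [actRight, actLeft] <;> split_ifs <;>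
    simp [smul_comm, mul_assoc]

/-- Insert `1` as the entry `a j`. -/
def degenTuple {n : ℕ} (j : Fin (n + 1)) (x : M × (Fin n → A)) : M × (Fin (n + 1) → A) :=
  (x.1, fun l => if h : (l : ℕ) < j then x.2 ⟨l, by omega⟩
    else if h' : (l : ℕ) = j then 1 else x.2 ⟨l - 1, by omega⟩)

/-- This is what makes inserting 1 preserve multilinearity; the witness is `j.succAbove p`, the new
position of the old entry `p`. -/
theorem degenTuple_update {n : ℕ} (j : Fin (n + 1)) (p : Fin n) (m : M) (a : Fin n → A) :
    ∃ q : Fin (n + 1), ∀ y, degenTuple j (m, Function.update a p y) =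
      (m, Function.update (degenTuple j (m, a)).2 q y) := by
  refine ⟨j.succAbove p, fun y => Prod.ext rfl (funext fun l => ?_)⟩
  rcases j with ⟨j, hj⟩
  rcases p with ⟨p, hp⟩
  rcases l with ⟨l, hl⟩
  simp only [degenTuple, Function.update_apply, Fin.succAbove, Fin.ext_iff, Fin.lt_def,
    Fin.castSucc_mk, Fin.succ_mk]
  split_ifs <;> first | rfl | (simp only [] at *; omega)

theorem faceTuple_degenTuple_self {n : ℕ} (j : Fin (n + 1)) (x : M × (Fin n → A)) :
    faceTuple j.castSucc (degenTuple j x) = x := by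
  rcases j with ⟨j, hj⟩
  refine Prod.ext ?_ (funext fun l => ?_)
  · rcases j with _ | j <;> simp [faceTuple, degenTuple] <;>
      (repeat' first | rfl | omega | (simp [smul_smul, mul_assoc, smul_comm]; done) | split)
  · rcases l with ⟨l, hl⟩
    simp only [faceTuple, degenTuple, Fin.castSucc_mk, Fin.succ_mk]
    split_ifs <;> first | rfl | omega | simp

theorem faceTuple_degenTuple_succ {n : ℕ} (j : Fin (n + 1)) (x : M × (Fin n → A)) :
    faceTuple j.succ (degenTuple j x) = x := by
  rcases j with ⟨j, hj⟩
  refine Prod.ext ?_ (funext fun l => ?_)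
  · rcases j with _ | j <;> simp [faceTuple, degenTuple] <;>
      (repeat' first | rfl | omega | (simp [smul_smul, mul_assoc, smul_comm]; done) | split)
  · rcases l with ⟨l, hl⟩
    simp only [faceTuple, degenTuple, Fin.castSucc_mk, Fin.succ_mk]
    split_ifs <;> first | rfl | omega | simp

theorem faceTuple_degenTuple_of_le {n : ℕ} (i : Fin (n + 2)) (j : Fin (n + 1))
    (h : (i : ℕ) ≤ j) (x : M × (Fin (n + 1) → A)) :
    faceTuple i.castSucc (degenTuple j.succ x) = degenTuple j (faceTuple i x) := by
  rcases i with ⟨i, hi⟩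
  rcases j with ⟨j, hj⟩
  simp only at h
  refine Prod.ext ?_ (funext fun l => ?_)
  · rcases i with _ | i <;> rcases j with _ | j <;> simp [faceTuple, degenTuple] <;>
      (repeat' first | rfl | omega | (simp [smul_smul, mul_assoc, smul_comm]; done) | split)
  · rcases l with ⟨_ | l, hl⟩
    all_goals
      simp only [faceTuple, degenTuple, Fin.castSucc_mk, Fin.succ_mk]
      split_ifs <;> first | rfl | omega | (congr 1; ext; simp; omega) | skip
      all_goals first | (congr 2; ext; simp; omega) | (congr 1; simp; omega) | simp

theorem faceTuple_degenTuple_of_lt {n : ℕ} (i : Fin (n + 2)) (j : Fin (n + 1))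
    (h : (j : ℕ) < i) (x : M × (Fin (n + 1) → A)) :
    faceTuple i.succ (degenTuple j.castSucc x) = degenTuple j (faceTuple i x) := by
  rcases i with ⟨i, hi⟩
  rcases j with ⟨j, hj⟩
  simp only at h
  refine Prod.ext ?_ (funext fun l => ?_)
  · rcases i with _ | i <;> rcases j with _ | j <;> simp [faceTuple, degenTuple] <;>
      (repeat' first | rfl | omega | (simp [smul_smul, mul_assoc, smul_comm]; done) | split)
  · rcases l with ⟨_ | l, hl⟩
    all_goals
      simp only [faceTuple, degenTuple, Fin.castSucc_mk, Fin.succ_mk]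
      split_ifs <;> first | rfl | omega | (congr 1; ext; simp; omega) | skip
      all_goals first | (congr 2; ext; simp; omega) | (congr 1; simp; omega) | simp

/-- Face `i` closes junction `i`. Junctions before it keep their number, and those after it drop by
one; this and the next three lemmas record the renumbering. -/
theorem faceTuple_actRight_of_lt [SMulCommClass A Aᵐᵒᵖ M] {n : ℕ} (i : Fin (n + 2))
    (j : Fin (n + 1)) (h : (j : ℕ) < i) (b : A) (x : M × (Fin (n + 1) → A)) :
    faceTuple i (actRight j.castSucc b x) = actRight j b (faceTuple i x) := by
  rcases i with ⟨i, hi⟩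
  rcases j with ⟨j, hj⟩
  simp only at h
  refine Prod.ext ?_ (funext fun l => ?_)
  · rcases i with _ | i <;> rcases j with _ | j <;> simp [faceTuple, actRight] <;>
      (repeat' first | rfl | omega | (simp [smul_smul, mul_assoc, smul_comm]; done) | split)
  · simp only [faceTuple, actRight, Fin.val_castSucc, Fin.val_succ]
    split_ifs <;> first | rfl | omega | simp [mul_assoc]

theorem faceTuple_actLeft_of_lt [SMulCommClass A Aᵐᵒᵖ M] {n : ℕ} (i : Fin (n + 2))
    (j : Fin (n + 1)) (h : (j : ℕ) < i) (b : A) (x : M × (Fin (n + 1) → A)) :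
    faceTuple i (actLeft j.castSucc b x) = actLeft j b (faceTuple i x) := by
  rcases i with ⟨i, hi⟩
  rcases j with ⟨j, hj⟩
  simp only at h
  refine Prod.ext ?_ (funext fun l => ?_)
  · rcases i with _ | i <;> rcases j with _ | j <;> simp [faceTuple, actLeft] <;>
      (repeat' first | rfl | omega | (simp [smul_smul, mul_assoc, smul_comm]; done) | split)
  · simp only [faceTuple, actLeft, Fin.val_castSucc, Fin.val_succ]
    split_ifs <;> first | rfl | omega | simp [mul_assoc]

theorem faceTuple_actRight_of_le [SMulCommClass A Aᵐᵒᵖ M] {n : ℕ} (i : Fin (n + 2))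
    (j : Fin (n + 1)) (h : (i : ℕ) ≤ j) (b : A) (x : M × (Fin (n + 1) → A)) :
    faceTuple i (actRight j.succ b x) = actRight j b (faceTuple i x) := by
  rcases i with ⟨i, hi⟩
  rcases j with ⟨j, hj⟩
  simp only at h
  refine Prod.ext ?_ (funext fun l => ?_)
  · rcases i with _ | i <;> rcases j with _ | j <;> simp [faceTuple, actRight] <;>
      (repeat' first | rfl | omega | (simp [smul_smul, mul_assoc, smul_comm]; done) | split)
  · simp only [faceTuple, actRight, Fin.val_castSucc, Fin.val_succ]
    split_ifs <;> first | rfl | omega | simp [mul_assoc]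

theorem faceTuple_actLeft_of_le [SMulCommClass A Aᵐᵒᵖ M] {n : ℕ} (i : Fin (n + 2))
    (j : Fin (n + 1)) (h : (i : ℕ) ≤ j) (b : A) (x : M × (Fin (n + 1) → A)) :
    faceTuple i (actLeft j.succ b x) = actLeft j b (faceTuple i x) := by
  rcases i with ⟨i, hi⟩
  rcases j with ⟨j, hj⟩
  simp only at h
  refine Prod.ext ?_ (funext fun l => ?_)
  · rcases i with _ | i <;> rcases j with _ | j <;> simp [faceTuple, actLeft] <;>
      (repeat' first | rfl | omega | (simp [smul_smul, mul_assoc, smul_comm]; done) | split)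
  · simp only [faceTuple, actLeft, Fin.val_castSucc, Fin.val_succ]
    split_ifs <;> first | rfl | omega | simp [mul_assoc]

/-- The two slots at junction `i` are multiplied together, so this is (xb)y = x(by), including the
wrap-around junction closed by the last face. -/
theorem faceTuple_actRight_self [SMulCommClass A Aᵐᵒᵖ M] {n : ℕ} (i : Fin (n + 2)) (b : A)
    (x : M × (Fin (n + 1) → A)) :
    faceTuple i (actRight i b x) = faceTuple i (actLeft i b x) := by
  rcases i with ⟨i, hi⟩
  refine Prod.ext ?_ (funext fun l => ?_)
  · rcases i with _ | i <;> simp [faceTuple, actRight, actLeft] <;>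
      (repeat' first | rfl | omega | (simp [smul_smul, mul_assoc, smul_comm]; done) | split)
  · simp only [faceTuple, actRight, actLeft, Fin.val_castSucc, Fin.val_succ]
    split_ifs <;> first | rfl | omega | simp [mul_assoc]

/-- Rotation sends junction j to junction j + 1 cyclically; the last junction, from slot n to slot
0, becomes junction 0. -/
theorem rotTuple_actRight_last {n : ℕ} (b : A) (x : A × (Fin n → A)) :
    rotTuple (actRight (Fin.last n) b x) = actRight 0 b (rotTuple x) := by
  cases n with
  | zero => rfl
  | succ n =>
    refine Prod.ext ?_ (funext fun l => ?_)
    · simp [rotTuple, actRight]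
    · refine Fin.cases ?_ (fun l => ?_) l <;> simp [rotTuple, actRight, Nat.ne_of_lt]

theorem rotTuple_actLeft_last {n : ℕ} (b : A) (x : A × (Fin n → A)) :
    rotTuple (actLeft (Fin.last n) b x) = actLeft 0 b (rotTuple x) := by
  cases n with
  | zero => rfl
  | succ n =>
    refine Prod.ext ?_ (funext fun l => ?_)
    · simp [rotTuple, actLeft]
    · refine Fin.cases ?_ (fun l => ?_) l <;> simp [rotTuple, actLeft]
      intro h
      exact absurd h (by omega)

theorem rotTuple_actRight_castSucc {n : ℕ} (j : Fin n) (b : A) (x : A × (Fin n → A)) :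
    rotTuple (actRight j.castSucc b x) = actRight j.succ b (rotTuple x) := by
  cases n with
  | zero => exact j.elim0
  | succ n =>
    refine Prod.ext ?_ (funext fun l => ?_)
    · simp [rotTuple, actRight]
      intro h
      exact absurd h (by omega)
    · refine Fin.cases ?_ (fun l => ?_) l <;> simp [rotTuple, actRight, eq_comm]

theorem rotTuple_actLeft_castSucc {n : ℕ} (j : Fin n) (b : A) (x : A × (Fin n → A)) :
    rotTuple (actLeft j.castSucc b x) = actLeft j.succ b (rotTuple x) := by
  cases n with
  | zero => exact j.elim0
  | succ n =>
    refine Prod.ext ?_ (funext fun l => ?_)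
    · simp [rotTuple, actLeft, eq_comm]
    · refine Fin.cases ?_ (fun l => ?_) l <;> simp [rotTuple, actLeft]
      intro h
      exact absurd h (by omega)

end TupleLemmas

/-! ### The corresponding linear operators on Zₙ(A/k, M). -/

section Operators

variable {k : Type u} {A : Type v} [CommRing k] [Ring A] [Algebra k A]
variable {M : Type w} [AddCommGroup M] [Module k M] [Module A M] [Module Aᵐᵒᵖ M]
  [IsScalarTower k A M] [IsScalarTower k Aᵐᵒᵖ M] [SMulCommClass A Aᵐᵒᵖ M]
variable {n : ℕ} {Q : Type*} [AddCommGroup Q] [Module k Q] {f : M × (Fin n → A) → Q}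

namespace IsMultilin

theorem actRight_add (hf : IsMultilin k M f) (j : Fin (n + 1)) (b c : A) (x : M × (Fin n → A)) :
    f (actRight j (b + c) x) = f (actRight j b x) + f (actRight j c x) := by
  induction j using Fin.cases with
  | zero => simp only [actRight_zero, MulOpposite.op_add, add_smul, hf.add_left]
  | succ j => simp only [actRight_succ, mul_add, hf.add_right]

theorem actRight_smul (hf : IsMultilin k M f) (j : Fin (n + 1)) (c : k) (b : A)
    (x : M × (Fin n → A)) : f (actRight j (c • b) x) = c • f (actRight j b x) := by
  induction j using Fin.cases with
  | zero => simp only [actRight_zero, op_smul, smul_assoc, hf.smul_left]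
  | succ j => simp only [actRight_succ, mul_smul_comm, hf.smul_right]

theorem actLeft_add (hf : IsMultilin k M f) (j : Fin (n + 1)) (b c : A) (x : M × (Fin n → A)) :
    f (actLeft j (b + c) x) = f (actLeft j b x) + f (actLeft j c x) := by
  induction j using Fin.lastCases with
  | last => simp only [actLeft_last, add_smul, hf.add_left]
  | cast j => simp only [actLeft_castSucc, add_mul, hf.add_right]

theorem actLeft_smul (hf : IsMultilin k M f) (j : Fin (n + 1)) (c : k) (b : A)
    (x : M × (Fin n → A)) : f (actLeft j (c • b) x) = c • f (actLeft j b x) := by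
  induction j using Fin.lastCases with
  | last => simp only [actLeft_last, smul_assoc, hf.smul_left]
  | cast j => simp only [actLeft_castSucc, smul_mul_assoc, hf.smul_right]

/-- Elements of `⊥` are scalars, which multilinearity already moves between slots. So over `⊥` the
relations impose nothing, and every multilinear function descends. -/
theorem actRight_eq_actLeft (hf : IsMultilin k M f) (j : Fin (n + 1)) (b : A)
    (x : M × (Fin n → A)) (hb : b ∈ (⊥ : Subalgebra k A)) :
    f (actRight j b x) = f (actLeft j b x) := by
  obtain ⟨c, rfl⟩ := Algebra.mem_bot.1 hb
  rw [Algebra.algebraMap_eq_smul_one, hf.actRight_smul, hf.actLeft_smul, actRight_one,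
    actLeft_one]

/-- Both slot multiplications have this shape, with the identity in all slots but one. -/
theorem comp_slots (hf : IsMultilin k M f) (φ : M →ₗ[k] M) (ψ : Fin n → A →ₗ[k] A) :
    IsMultilin k M fun x : M × (Fin n → A) => f (φ x.1, fun i => ψ i (x.2 i)) := by
  have h : ∀ (a : Fin n → A) (i : Fin n) (y : A), (fun l => ψ l (Function.update a i y l)) =
      Function.update (fun l => ψ l (a l)) i (ψ i y) := by
    intro a i y
    funext l
    by_cases hl : l = i
    · subst hl
      simp
    · simp [hl]
  constructor <;> intros
  · simp only [map_add, hf.add_left]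
  · simp only [map_smul, hf.smul_left]
  · simp only [h, map_add, hf.add_right]
  · simp only [h, map_smul, hf.smul_right]

theorem comp_actRight (hf : IsMultilin k M f) (j : Fin (n + 1)) (b : A) :
    IsMultilin k M fun x => f (actRight j b x) := by
  convert hf.comp_slots (if (j : ℕ) = 0 then Algebra.lsmul k k M (op b) else LinearMap.id)
    (fun i => if (i : ℕ) + 1 = j then LinearMap.mulRight k b else LinearMap.id) using 3 with x
  refine Prod.ext ?_ (funext fun l => ?_) <;> simp only [actRight] <;> split_ifs <;> rfl

theorem comp_actLeft (hf : IsMultilin k M f) (j : Fin (n + 1)) (b : A) :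
    IsMultilin k M fun x => f (actLeft j b x) := by
  convert hf.comp_slots (if (j : ℕ) = n then Algebra.lsmul k k M b else LinearMap.id)
    (fun i => if (i : ℕ) = j then LinearMap.mulLeft k b else LinearMap.id) using 3 with x
  refine Prod.ext ?_ (funext fun l => ?_) <;> simp only [actLeft] <;> split_ifs <;> rfl

theorem comp_degenTuple {f : M × (Fin (n + 1) → A) → Q} (hf : IsMultilin k M f)
    (j : Fin (n + 1)) : IsMultilin k M fun x => f (degenTuple j x) := by
  constructor
  · intro m m' a
    exact hf.add_left m m' _
  · intro c m a
    exact hf.smul_left c m _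
  · intro m a i y z
    obtain ⟨q, h⟩ := degenTuple_update j i m a
    simp only [h, hf.add_right]
  · intro m a i c y
    obtain ⟨q, h⟩ := degenTuple_update j i m a
    simp only [h, hf.smul_right]

end IsMultilin

/-- The linear map on `Zₙ(A/k, M)` induced by a function linear in every entry. -/
noncomputable def liftBot (f : M × (Fin n → A) → Q) (hf : IsMultilin k M f) :
    Z (⊥ : Subalgebra k A) M n →ₗ[k] Q :=
  liftZ ⊥ f hf hf.actRight_eq_actLeft

@[simp] theorem liftBot_cls (f : M × (Fin n → A) → Q) (hf : IsMultilin k M f)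
    (x : M × (Fin n → A)) : liftBot f hf (cls ⊥ x) = f x :=
  liftZ_cls _ _ _ x

/-- Right multiplication of the entry in slot `j`. -/
noncomputable def mulSlotRight (k : Type u) {A : Type v} [CommRing k] [Ring A] [Algebra k A]
    (M : Type w) [AddCommGroup M] [Module k M] [Module A M] [Module Aᵐᵒᵖ M]
    [IsScalarTower k A M] [IsScalarTower k Aᵐᵒᵖ M] [SMulCommClass A Aᵐᵒᵖ M] {n : ℕ}
    (j : Fin (n + 1)) : A →ₗ[k] Module.End k (Z (⊥ : Subalgebra k A) M n) where
  toFun b := liftBot (fun x => cls ⊥ (actRight j b x)) (isMultilin_cls.comp_actRight j b)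
  map_add' b c := hom_ext_cls fun x => by simp [isMultilin_cls.actRight_add]
  map_smul' c b := hom_ext_cls fun x => by simp [isMultilin_cls.actRight_smul]

/-- Left multiplication of the entry in the slot that follows `j`. -/
noncomputable def mulSlotLeft (k : Type u) {A : Type v} [CommRing k] [Ring A] [Algebra k A]
    (M : Type w) [AddCommGroup M] [Module k M] [Module A M] [Module Aᵐᵒᵖ M]
    [IsScalarTower k A M] [IsScalarTower k Aᵐᵒᵖ M] [SMulCommClass A Aᵐᵒᵖ M] {n : ℕ}
    (j : Fin (n + 1)) : A →ₗ[k] Module.End k (Z (⊥ : Subalgebra k A) M n) where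
  toFun b := liftBot (fun x => cls ⊥ (actLeft j b x)) (isMultilin_cls.comp_actLeft j b)
  map_add' b c := hom_ext_cls fun x => by simp [isMultilin_cls.actLeft_add]
  map_smul' c b := hom_ext_cls fun x => by simp [isMultilin_cls.actLeft_smul]

@[simp] theorem mulSlotRight_cls (j : Fin (n + 1)) (b : A) (x : M × (Fin n → A)) :
    mulSlotRight k M j b (cls ⊥ x) = cls ⊥ (actRight j b x) := by
  simp [mulSlotRight]

@[simp] theorem mulSlotLeft_cls (j : Fin (n + 1)) (b : A) (x : M × (Fin n → A)) :
    mulSlotLeft k M j b (cls ⊥ x) = cls ⊥ (actLeft j b x) := by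
  simp [mulSlotLeft]

variable (k M) in
/-- The degeneracy which inserts `1` as the entry `a j`. -/
noncomputable def degen (A : Type v) [Ring A] [Algebra k A] [Module A M] [Module Aᵐᵒᵖ M]
    [IsScalarTower k A M] [IsScalarTower k Aᵐᵒᵖ M] [SMulCommClass A Aᵐᵒᵖ M] (j : Fin (n + 1)) :
    Z (⊥ : Subalgebra k A) M n →ₗ[k] Z (⊥ : Subalgebra k A) M (n + 1) :=
  liftBot (fun x => cls ⊥ (degenTuple j x)) (isMultilin_cls.comp_degenTuple j)

@[simp] theorem degen_cls (j : Fin (n + 1)) (x : M × (Fin n → A)) :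
    degen k M A j (cls ⊥ x) = cls ⊥ (degenTuple j x) := by
  simp [degen]

theorem face_degen_self (j : Fin (n + 1)) :
    face ⊥ M j.castSucc ∘ₗ degen k M A j = LinearMap.id :=
  hom_ext_cls fun x => by simp [faceTuple_degenTuple_self]

theorem face_degen_succ (j : Fin (n + 1)) :
    face ⊥ M j.succ ∘ₗ degen k M A j = LinearMap.id :=
  hom_ext_cls fun x => by simp [faceTuple_degenTuple_succ]

theorem face_degen_of_le (i : Fin (n + 2)) (j : Fin (n + 1)) (h : (i : ℕ) ≤ j) :
    face ⊥ M i.castSucc ∘ₗ degen k M A j.succ = degen k M A j ∘ₗ face ⊥ M i :=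
  hom_ext_cls fun x => by simp [faceTuple_degenTuple_of_le i j h]

theorem face_degen_of_lt (i : Fin (n + 2)) (j : Fin (n + 1)) (h : (j : ℕ) < i) :
    face ⊥ M i.succ ∘ₗ degen k M A j.castSucc = degen k M A j ∘ₗ face ⊥ M i :=
  hom_ext_cls fun x => by simp [faceTuple_degenTuple_of_lt i j h]

end Operators

/-- A finite family of pairs in `B` whose sum of tensors is a separability idempotent of `B`. -/
structure SepFamily {k : Type u} {A : Type v} [CommRing k] [Ring A] [Algebra k A]
    (B : Subalgebra k A) where
  /-- The pairs of factors of the idempotent. -/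
  pairs : Finset (B × B)
  sum_mul : ∑ p ∈ pairs, (p.1 : A) * p.2 = 1
  comm : ∀ b : B, ∑ p ∈ pairs, (b * p.1) ⊗ₜ[k] p.2 = ∑ p ∈ pairs, p.1 ⊗ₜ[k] (p.2 * b)

/-- The idempotent is s(1): bilinearity of the section gives b s(1) = s(b) = s(1) b. -/
theorem exists_sepFamily {k : Type u} {A : Type v} [CommRing k] [Ring A] [Algebra k A]
    {B : Subalgebra k A} (hB : IsSeparableAlg k B) : Nonempty (SepFamily B) := by
  obtain ⟨s, h1, h2, h3⟩ := hB
  obtain ⟨S, hS⟩ := TensorProduct.exists_finset (s 1)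
  refine ⟨⟨S, ?_, fun b => ?_⟩⟩
  · have h := congrArg (Subtype.val : B → A) (h3 1)
    rw [hS, map_sum] at h
    simpa using h
  · have h : (LinearMap.mulLeft k b).rTensor B (s 1) = (LinearMap.mulRight k b).lTensor B (s 1) := by
      rw [← h1, ← h2, mul_one, one_mul]
    rw [hS, map_sum, map_sum] at h
    simpa using h

/-! ### Inserting the separability idempotent at junctions. -/

section Junction

variable {k : Type u} {A : Type v} [CommRing k] [Ring A] [Algebra k A] {B : Subalgebra k A}
variable (S : SepFamily B)
variable (M : Type w) [AddCommGroup M] [Module k M] [Module A M] [Module Aᵐᵒᵖ M]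
  [IsScalarTower k A M] [IsScalarTower k Aᵐᵒᵖ M] [SMulCommClass A Aᵐᵒᵖ M]

namespace SepFamily

/-- `Ψ` is restricted to `B` in both variables, so the identity is used in B ⊗ B itself and never
has to be transported to A ⊗ A. -/
theorem sum_comm_apply {Q : Type*} [AddCommGroup Q] [Module k Q] (Ψ : A →ₗ[k] A →ₗ[k] Q)
    {b : A} (hb : b ∈ B) :
    ∑ p ∈ S.pairs, Ψ (b * p.1) p.2 = ∑ p ∈ S.pairs, Ψ p.1 (p.2 * b) := by
  have h := congrArg (TensorProduct.lift (Ψ.compl₁₂ B.val.toLinearMap B.val.toLinearMap))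
    (S.comm ⟨b, hb⟩)
  simpa [map_sum] using h

/-- Insert the separability idempotent at the junction between slot `j` and the slot that
follows it. -/
noncomputable def junction {n : ℕ} (j : Fin (n + 1)) :
    Module.End k (Z (⊥ : Subalgebra k A) M n) :=
  ∑ p ∈ S.pairs, mulSlotRight k M j (p.1 : A) * mulSlotLeft k M j (p.2 : A)

variable {M}

theorem junction_cls {n : ℕ} (j : Fin (n + 1)) (x : M × (Fin n → A)) :
    S.junction M j (cls ⊥ x) =
      ∑ p ∈ S.pairs, cls (k := k) ⊥ (actRight j (p.1 : A) (actLeft j (p.2 : A) x)) := by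
  simp [junction, LinearMap.sum_apply]

/-- Both sides insert be = eb at the junction: Σ (x b p₁, p₂ y) = Σ (x p₁, p₂ b y). -/
theorem junction_actRight {n : ℕ} (j : Fin (n + 1)) {b : A} (hb : b ∈ B)
    (x : M × (Fin n → A)) :
    S.junction M j (cls ⊥ (actRight j b x)) = S.junction M j (cls ⊥ (actLeft j b x)) := by
  have h := S.sum_comm_apply ((LinearMap.mul k (Module.End k (Z (⊥ : Subalgebra k A) M n))).compl₁₂
    (mulSlotRight k M j) (mulSlotLeft k M j)) hb
  have h' := LinearMap.congr_fun h (cls ⊥ x)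
  simp only [LinearMap.sum_apply, LinearMap.compl₁₂_apply, LinearMap.mul_apply',
    Module.End.mul_apply, mulSlotLeft_cls, mulSlotRight_cls] at h'
  simp only [junction_cls, ← actRight_actLeft j j, actRight_actRight, actLeft_actLeft]
  simpa only [← actRight_actLeft j j] using h'

theorem junction_comm {n : ℕ} {i j : Fin (n + 1)} (h : i ≠ j) :
    S.junction M i * S.junction M j = S.junction M j * S.junction M i := by
  refine hom_ext_cls fun x => ?_
  simp only [Module.End.mul_apply, junction_cls, map_sum]
  rw [Finset.sum_comm]
  refine Finset.sum_congr rfl fun p _ => Finset.sum_congr rfl fun q _ => ?_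
  congr 1
  rw [← actRight_actLeft j i, actRight_comm h, actLeft_comm h, actRight_actLeft i j]

theorem face_junction_self {n : ℕ} (i : Fin (n + 2)) :
    face ⊥ M i ∘ₗ S.junction M i = face (k := k) (⊥ : Subalgebra k A) M i := by
  refine hom_ext_cls fun x => ?_
  simp only [LinearMap.comp_apply, junction_cls, map_sum, face_cls, faceTuple_actRight_self,
    actLeft_actLeft]
  -- After the face, p₁ and p₂ stand next to each other; linearity in the multiplier collects them
  -- into Σ p₁p₂ = 1.
  have h : ∑ p ∈ S.pairs, (face ⊥ M i) (mulSlotLeft k M i ((p.1 : A) * p.2) (cls ⊥ x)) =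
      face (k := k) (⊥ : Subalgebra k A) M i (cls ⊥ x) := by
    rw [← map_sum, ← LinearMap.sum_apply, ← map_sum, S.sum_mul, mulSlotLeft_cls, actLeft_one]
  simpa using h

theorem face_junction_of_lt {n : ℕ} (i : Fin (n + 2)) (j : Fin (n + 1)) (h : (j : ℕ) < i) :
    face ⊥ M i ∘ₗ S.junction M j.castSucc = S.junction M j ∘ₗ face ⊥ M i := by
  refine hom_ext_cls fun x => ?_
  simp only [LinearMap.comp_apply, junction_cls, map_sum, face_cls,
    faceTuple_actRight_of_lt i j h, faceTuple_actLeft_of_lt i j h]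

theorem face_junction_of_le {n : ℕ} (i : Fin (n + 2)) (j : Fin (n + 1)) (h : (i : ℕ) ≤ j) :
    face ⊥ M i ∘ₗ S.junction M j.succ = S.junction M j ∘ₗ face ⊥ M i := by
  refine hom_ext_cls fun x => ?_
  simp only [LinearMap.comp_apply, junction_cls, map_sum, face_cls,
    faceTuple_actRight_of_le i j h, faceTuple_actLeft_of_le i j h]

theorem rot_junction_last (n : ℕ) :
    rot ⊥ n ∘ₗ S.junction A (Fin.last n) = S.junction A 0 ∘ₗ rot ⊥ n := by
  refine hom_ext_cls fun x => ?_
  simp only [LinearMap.comp_apply, junction_cls, map_sum, rot_cls, rotTuple_actRight_last,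
    rotTuple_actLeft_last]

theorem rot_junction_castSucc {n : ℕ} (j : Fin n) :
    rot ⊥ n ∘ₗ S.junction A j.castSucc = S.junction A j.succ ∘ₗ rot ⊥ n := by
  refine hom_ext_cls fun x => ?_
  simp only [LinearMap.comp_apply, junction_cls, map_sum, rot_cls, rotTuple_actRight_castSucc,
    rotTuple_actLeft_castSucc]

/-- In Zₙ(A/B, M) the factor p₁ may cross the junction, where it meets p₂, and Σ p₁p₂ = 1. -/
theorem projMap_junction {n : ℕ} (j : Fin (n + 1)) :
    projMap M bot_le n ∘ₗ S.junction M j = projMap M (bot_le : ⊥ ≤ B) n := by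
  refine hom_ext_cls fun x => ?_
  simp only [LinearMap.comp_apply, junction_cls, map_sum, projMap_cls]
  have h : ∑ p ∈ S.pairs,
      projMap M (bot_le : ⊥ ≤ B) n (mulSlotLeft k M j ((p.1 : A) * p.2) (cls ⊥ x)) =
      projMap M (bot_le : ⊥ ≤ B) n (cls ⊥ x) := by
    rw [← map_sum, ← LinearMap.sum_apply, ← map_sum, S.sum_mul, mulSlotLeft_cls, actLeft_one]
  rw [← projMap_cls (bot_le : ⊥ ≤ B), ← h]
  refine Finset.sum_congr rfl fun p _ => ?_
  rw [cls_actRight j p.1.2, actLeft_actLeft, mulSlotLeft_cls, projMap_cls]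

variable (M) in
/-- The product of the first `j` junction operators. -/
noncomputable def junctions (n : ℕ) : ℕ → Module.End k (Z (⊥ : Subalgebra k A) M n)
  | 0 => 1
  | j + 1 => junctions n j * if h : j < n + 1 then S.junction M ⟨j, h⟩ else 1

theorem junctions_zero (n : ℕ) : S.junctions M n 0 = 1 := rfl

theorem junctions_succ (n j : ℕ) (h : j < n + 1) :
    S.junctions M n (j + 1) = S.junctions M n j * S.junction M ⟨j, h⟩ := by
  rw [junctions, dif_pos h]

theorem junctions_comm {n : ℕ} (i : Fin (n + 1)) (j : ℕ) (h : j ≤ i) :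
    S.junctions M n j * S.junction M i = S.junction M i * S.junctions M n j := by
  induction j with
  | zero => rw [junctions_zero, one_mul, mul_one]
  | succ j ih =>
    rw [S.junctions_succ n j (by omega), mul_assoc, S.junction_comm (Fin.ne_of_lt h), ← mul_assoc,
      ih (by omega), mul_assoc]

theorem face_junctions_of_le {n : ℕ} (i : Fin (n + 2)) (j : ℕ) (h : j ≤ i) :
    face ⊥ M i ∘ₗ S.junctions M (n + 1) j = S.junctions M n j ∘ₗ face ⊥ M i := by
  induction j with
  | zero => rfl
  | succ j ih =>
    rw [S.junctions_succ (n + 1) j (by omega), S.junctions_succ n j (by omega),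
      Module.End.mul_eq_comp, Module.End.mul_eq_comp, ← LinearMap.comp_assoc, ih (by omega),
      LinearMap.comp_assoc, LinearMap.comp_assoc]
    congr 1
    exact S.face_junction_of_lt i ⟨j, by omega⟩ h

/-- The factor at junction `i` is among the first j + 1 and is absorbed by the face, which leaves j
factors after renumbering. -/
theorem face_junctions_of_lt {n : ℕ} (i : Fin (n + 2)) (j : ℕ) (h : (i : ℕ) ≤ j) (hj : j < n + 2) :
    face ⊥ M i ∘ₗ S.junctions M (n + 1) (j + 1) = S.junctions M n j ∘ₗ face ⊥ M i := by
  induction j, h using Nat.le_induction with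
  | base =>
    rw [S.junctions_succ (n + 1) i i.isLt, Module.End.mul_eq_comp, ← LinearMap.comp_assoc,
      S.face_junctions_of_le i i le_rfl, LinearMap.comp_assoc]
    congr 1
    exact S.face_junction_self i
  | succ j h ih =>
    rw [S.junctions_succ (n + 1) (j + 1) hj, S.junctions_succ n j (by omega),
      Module.End.mul_eq_comp, Module.End.mul_eq_comp, ← LinearMap.comp_assoc, ih (by omega),
      LinearMap.comp_assoc, LinearMap.comp_assoc]
    congr 1
    exact S.face_junction_of_le i ⟨j, by omega⟩ h

variable (M) in
/-- Insert the separability idempotent at every junction. -/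
noncomputable def avg (n : ℕ) : Module.End k (Z (⊥ : Subalgebra k A) M n) :=
  S.junctions M n (n + 1)

theorem face_avg {n : ℕ} (i : Fin (n + 2)) :
    face ⊥ M i ∘ₗ S.avg M (n + 1) = S.avg M n ∘ₗ face ⊥ M i :=
  S.face_junctions_of_lt i (n + 1) (by omega) (by omega)

/-- Rotation turns J₀⋯J_{j-1} into J₁⋯J_j; the extra J₀ in front completes an initial segment again.
-/
theorem junction_zero_rot_junctions (n j : ℕ) (h : j < n + 1) :
    S.junction A 0 ∘ₗ rot ⊥ n ∘ₗ S.junctions A n j = S.junctions A n (j + 1) ∘ₗ rot ⊥ n := by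
  induction j with
  | zero =>
    rw [S.junctions_succ n 0 h, junctions_zero, one_mul]
    rfl
  | succ j ih =>
    have h1 : (⟨j, by omega⟩ : Fin (n + 1)) = Fin.castSucc ⟨j, by omega⟩ := rfl
    have h2 : (⟨j + 1, h⟩ : Fin (n + 1)) = Fin.succ ⟨j, by omega⟩ := rfl
    rw [S.junctions_succ n (j + 1) h, S.junctions_succ n j (by omega), Module.End.mul_eq_comp,
      ← LinearMap.comp_assoc, ← LinearMap.comp_assoc, LinearMap.comp_assoc _ (rot ⊥ n),
      ih (by omega), LinearMap.comp_assoc, h1, S.rot_junction_castSucc, ← LinearMap.comp_assoc, h2,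
      Module.End.mul_eq_comp, S.junctions_succ n j (by omega)]
    rfl

theorem rot_avg (n : ℕ) : rot ⊥ n ∘ₗ S.avg A n = S.avg A n ∘ₗ rot ⊥ n := by
  have h : (⟨n, by omega⟩ : Fin (n + 1)) = Fin.last n := rfl
  -- The last factor is moved to the front, since rotation turns it into the J₀ that the other
  -- factors need.
  conv_lhs => rw [avg, S.junctions_succ n n (by omega), S.junctions_comm _ n le_rfl,
    Module.End.mul_eq_comp, ← LinearMap.comp_assoc, h, S.rot_junction_last, LinearMap.comp_assoc,
    S.junction_zero_rot_junctions n n (by omega)]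
  rfl

theorem projMap_junctions (n j : ℕ) :
    projMap M bot_le n ∘ₗ S.junctions M n j = projMap M (bot_le : ⊥ ≤ B) n := by
  induction j with
  | zero => rfl
  | succ j ih =>
    by_cases h : j < n + 1
    · rw [S.junctions_succ n j h, Module.End.mul_eq_comp, ← LinearMap.comp_assoc, ih,
        S.projMap_junction]
    · rw [junctions, dif_neg h, mul_one, ih]

/-- The factors commute, so the one at junction `i` can be applied first, and it already identifies
the two tuples. -/
theorem junctions_actRight {n : ℕ} (i : Fin (n + 1)) (j : ℕ) (hj : (i : ℕ) < j) (hn : j ≤ n + 1)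
    {b : A} (hb : b ∈ B) (x : M × (Fin n → A)) :
    S.junctions M n j (cls ⊥ (actRight i b x)) = S.junctions M n j (cls ⊥ (actLeft i b x)) := by
  have h : ∃ f : Module.End k (Z (⊥ : Subalgebra k A) M n),
      S.junctions M n j = f * S.junction M i := by
    induction j, hj using Nat.le_induction with
    | base => exact ⟨_, S.junctions_succ n i i.isLt⟩
    | succ j hj ih =>
      obtain ⟨f, hf⟩ := ih (by omega)
      refine ⟨f * S.junction M ⟨j, by omega⟩, ?_⟩
      rw [S.junctions_succ n j (by omega), hf, mul_assoc, mul_assoc,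
        S.junction_comm (Fin.ne_of_lt hj)]
  obtain ⟨f, hf⟩ := h
  rw [hf, Module.End.mul_apply, Module.End.mul_apply, S.junction_actRight i hb]

end SepFamily
end Junction

/-! ### The alternating sum of a simplicial homotopy. -/

/-- Here `G i j` stands for d_i h_j and `K i j` for h_j d_i. The terms i = j and i = j + 1 telescope
through `F`; all the others cancel against `K`. -/
theorem sum_range_alternating_homotopy {X : Type*} [AddCommGroup X] (n : ℕ) (G K : ℕ → ℕ → X)
    (F : ℕ → X) (h0 : ∀ j < n + 1, G j j = F j) (h1 : ∀ j < n + 1, G (j + 1) j = F (j + 1))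
    (h2 : ∀ i j, i ≤ j → j < n → G i (j + 1) = K i j)
    (h3 : ∀ i j, j < i → i < n + 1 → G (i + 1) j = K i j) :
    ∑ j ∈ Finset.range (n + 1), ∑ i ∈ Finset.range (n + 2), (-1 : ℤ) ^ (i + j) • G i j +
      ∑ j ∈ Finset.range n, ∑ i ∈ Finset.range (n + 1), (-1 : ℤ) ^ (i + j) • K i j =
      F 0 - F (n + 1) := by
  -- `a j` is the part i < j of the j-th sum and `-c j` the part i > j + 1. The truncated j - 1 at j
  -- = 0 is harmless, the sum being empty there.
  let a : ℕ → X := fun j => ∑ i ∈ Finset.range j, (-1 : ℤ) ^ (i + j) • K i (j - 1)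
  let c : ℕ → X := fun j => ∑ i ∈ Finset.range (n - j), (-1 : ℤ) ^ (j + 1 + i + j) • K (j + 1 + i) j
  have hG : ∀ j ∈ Finset.range (n + 1),
      ∑ i ∈ Finset.range (n + 2), (-1 : ℤ) ^ (i + j) • G i j = a j + (F j - F (j + 1)) - c j := by
    intro j hj
    have hj := Finset.mem_range.1 hj
    rw [show n + 2 = j + 2 + (n - j) by omega, Finset.sum_range_add, Finset.sum_range_succ,
      Finset.sum_range_succ, h0 j hj, h1 j hj, Even.neg_one_pow ⟨j, rfl⟩,
      show j + 1 + j = j + j + 1 by ring, pow_succ, Even.neg_one_pow ⟨j, rfl⟩]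
    have e1 : ∑ i ∈ Finset.range j, (-1 : ℤ) ^ (i + j) • G i j = a j := by
      refine Finset.sum_congr rfl fun i hi => ?_
      have hi := Finset.mem_range.1 hi
      obtain _ | j := j
      · omega
      · rw [h2 i j (by omega) (by omega), Nat.add_sub_cancel]
    have e2 : ∑ i ∈ Finset.range (n - j), (-1 : ℤ) ^ (j + 2 + i + j) • G (j + 2 + i) j = - c j := by
      rw [← Finset.sum_neg_distrib]
      refine Finset.sum_congr rfl fun i hi => ?_
      have hi := Finset.mem_range.1 hi
      rw [show j + 2 + i = j + 1 + i + 1 by ring, h3 (j + 1 + i) j (by omega) (by omega),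
        show j + 1 + i + 1 + j = j + 1 + i + j + 1 by ring, pow_succ, mul_neg_one, neg_smul]
    rw [e1, e2]
    simp only [one_mul, one_smul, neg_smul]
    abel
  have hK : ∀ j ∈ Finset.range n,
      ∑ i ∈ Finset.range (n + 1), (-1 : ℤ) ^ (i + j) • K i j = c j - a (j + 1) := by
    intro j hj
    have hj := Finset.mem_range.1 hj
    rw [show n + 1 = j + 1 + (n - j) by omega, Finset.sum_range_add, sub_eq_neg_add]
    congr 1
    rw [← Finset.sum_neg_distrib]
    refine Finset.sum_congr rfl fun i hi => ?_
    rw [← add_assoc, pow_succ, mul_neg_one, neg_smul, neg_neg, Nat.add_sub_cancel]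
  rw [Finset.sum_congr rfl hG, Finset.sum_congr rfl hK, Finset.sum_sub_distrib,
    Finset.sum_add_distrib, Finset.sum_range_sub', Finset.sum_range_succ' a,
    Finset.sum_range_succ c, Finset.sum_sub_distrib]
  -- The sums of `a` and `c` cancel except at these two ends, which are empty sums.
  have ha : a 0 = 0 := Finset.sum_range_zero _
  have hc : c n = 0 := by simp [c]
  rw [ha, hc]
  abel

theorem sum_fin_alternating_homotopy {X : Type*} [AddCommGroup X] (n : ℕ)
    (G : Fin (n + 2) → Fin (n + 1) → X) (K : Fin (n + 1) → Fin n → X) (F : ℕ → X)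
    (h0 : ∀ j : Fin (n + 1), G j.castSucc j = F j)
    (h1 : ∀ j : Fin (n + 1), G j.succ j = F (j + 1))
    (h2 : ∀ (i : Fin (n + 1)) (j : Fin n), (i : ℕ) ≤ j → G i.castSucc j.succ = K i j)
    (h3 : ∀ (i : Fin (n + 1)) (j : Fin n), (j : ℕ) < i → G i.succ j.castSucc = K i j) :
    ∑ j : Fin (n + 1), ∑ i : Fin (n + 2), (-1 : ℤ) ^ ((i : ℕ) + j) • G i j +
      ∑ j : Fin n, ∑ i : Fin (n + 1), (-1 : ℤ) ^ ((i : ℕ) + j) • K i j = F 0 - F (n + 1) := by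
  have h := sum_range_alternating_homotopy n
    -- Extension by zero; the hypotheses and sums use only indices inside the range.
    (fun i j => if h : i < n + 2 ∧ j < n + 1 then G ⟨i, h.1⟩ ⟨j, h.2⟩ else 0)
    (fun i j => if h : i < n + 1 ∧ j < n then K ⟨i, h.1⟩ ⟨j, h.2⟩ else 0) F
    (fun j hj => by
      rw [dif_pos ⟨by omega, hj⟩]
      exact h0 ⟨j, hj⟩)
    (fun j hj => by
      rw [dif_pos ⟨by omega, hj⟩]
      exact h1 ⟨j, hj⟩)
    (fun i j hi hj => by
      rw [dif_pos ⟨by omega, by omega⟩, dif_pos ⟨by omega, by omega⟩]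
      exact h2 ⟨i, by omega⟩ ⟨j, hj⟩ hi)
    (fun i j hj hi => by
      by_cases hn : j < n
      · rw [dif_pos ⟨by omega, by omega⟩, dif_pos ⟨by omega, by omega⟩]
        exact h3 ⟨i, hi⟩ ⟨j, hn⟩ hj
      · omega)
  rw [← h]
  simp only [Finset.sum_range, Fin.is_lt, and_self, dite_true, Fin.eta]

/-! ### The section of the projection, and homotopies from the identity to `avg`. -/

section Retraction

variable {k : Type u} {A : Type v} [CommRing k] [Ring A] [Algebra k A] {B : Subalgebra k A}
variable (S : SepFamily B)
variable (M : Type w) [AddCommGroup M] [Module k M] [Module A M] [Module Aᵐᵒᵖ M]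
  [IsScalarTower k A M] [IsScalarTower k Aᵐᵒᵖ M] [SMulCommClass A Aᵐᵒᵖ M]

theorem IsMultilin.comp_linearMap {n : ℕ} {Q R : Type*} [AddCommGroup Q] [Module k Q]
    [AddCommGroup R] [Module k R] {f : M × (Fin n → A) → Q} (hf : IsMultilin k M f)
    (g : Q →ₗ[k] R) : IsMultilin k M fun x => g (f x) where
  add_left m m' a := by rw [hf.add_left, map_add]
  smul_left c m a := by rw [hf.smul_left, map_smul]
  add_right m a i y z := by rw [hf.add_right, map_add]
  smul_right m a i c y := by rw [hf.smul_right, map_smul]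

namespace SepFamily

/-- The section `Zₙ(A/B, M) → Zₙ(A/k, M)` of the projection given by the separability idempotent. -/
noncomputable def expand (n : ℕ) : Z B M n →ₗ[k] Z (⊥ : Subalgebra k A) M n :=
  liftZ B (fun x => S.avg M n (cls ⊥ x)) (isMultilin_cls.comp_linearMap M _)
    fun j _ x hb => S.junctions_actRight j (n + 1) j.isLt le_rfl hb x

variable {M}

@[simp] theorem expand_cls {n : ℕ} (x : M × (Fin n → A)) :
    S.expand M n (cls B x) = S.avg M n (cls ⊥ x) :=
  liftZ_cls _ _ _ x

theorem expand_projMap (n : ℕ) : S.expand M n ∘ₗ projMap M bot_le n = S.avg M n :=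
  hom_ext_cls fun x => by simp

theorem projMap_expand (n : ℕ) : projMap M bot_le n ∘ₗ S.expand M n = LinearMap.id :=
  hom_ext_cls fun x => by
    simpa [avg] using LinearMap.congr_fun (S.projMap_junctions n (n + 1)) (cls ⊥ x)

theorem face_expand {n : ℕ} (i : Fin (n + 2)) :
    face ⊥ M i ∘ₗ S.expand M (n + 1) = S.expand M n ∘ₗ face B M i :=
  hom_ext_cls fun x => by simpa using LinearMap.congr_fun (S.face_avg i) (cls ⊥ x)

theorem bMap_expand (n : ℕ) :
    bMap ⊥ M n ∘ₗ S.expand M (n + 1) = S.expand M n ∘ₗ bMap B M n := by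
  simp only [bMap, sum_comp', comp_sum', LinearMap.smul_comp, LinearMap.comp_smul, face_expand]

theorem bMap'_expand (n : ℕ) :
    bMap' ⊥ M n ∘ₗ S.expand M (n + 1) = S.expand M n ∘ₗ bMap' B M n := by
  simp only [bMap', sum_comp', comp_sum', LinearMap.smul_comp, LinearMap.comp_smul, face_expand]

theorem bMap'_avg (n : ℕ) :
    bMap' ⊥ M n ∘ₗ S.avg M (n + 1) = S.avg M n ∘ₗ bMap' ⊥ M n := by
  simp only [bMap', sum_comp', comp_sum', LinearMap.smul_comp, LinearMap.comp_smul, face_avg]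

theorem signedRot_expand (n : ℕ) :
    signedRot ⊥ n ∘ₗ S.expand A n = S.expand A n ∘ₗ signedRot B n :=
  hom_ext_cls fun x => by
    simpa [signedRot] using
      congrArg (fun y => (-1 : k) ^ n • y) (LinearMap.congr_fun (S.rot_avg n) (cls ⊥ x))

theorem normMap_expand (n : ℕ) :
    normMap ⊥ n ∘ₗ S.expand A n = S.expand A n ∘ₗ normMap B n := by
  have key : ∀ j : ℕ, (signedRot ⊥ n ^ j) ∘ₗ S.expand A n =
      S.expand A n ∘ₗ (signedRot B n ^ j) := by
    intro j
    induction j with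
    | zero => simp [Module.End.one_eq_id]
    | succ j ih => rw [pow_succ, pow_succ, Module.End.mul_eq_comp, Module.End.mul_eq_comp,
        LinearMap.comp_assoc, signedRot_expand, ← LinearMap.comp_assoc, ih, LinearMap.comp_assoc]
  simp only [normMap, sum_comp', comp_sum', key]

theorem colD_expand (p n : ℕ) :
    colD ⊥ p n ∘ₗ S.expand A (n + 1) = S.expand A n ∘ₗ colD B p n := by
  unfold colD
  split_ifs
  exacts [S.bMap_expand n, S.bMap'_expand n]

theorem rowD_expand (p n : ℕ) :
    rowD ⊥ p n ∘ₗ S.expand A n = S.expand A n ∘ₗ rowD B p n := by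
  unfold rowD
  split_ifs
  · rw [LinearMap.sub_comp, LinearMap.comp_sub, signedRot_expand, Module.End.one_eq_id,
      Module.End.one_eq_id, LinearMap.id_comp, LinearMap.comp_id]
  · exact S.normMap_expand n

/-! ### Contracting homotopies -/

variable (M) in
/-- The components of the homotopy from `1` to `S.avg` are alternating sums of these maps. -/
noncomputable def homotopyTerm {n : ℕ} (j : Fin (n + 1)) :
    Z (⊥ : Subalgebra k A) M n →ₗ[k] Z (⊥ : Subalgebra k A) M (n + 1) :=
  S.junctions M (n + 1) (j + 1) ∘ₗ degen k M A j

variable (M) in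
/-- The homotopy from `1` to `S.avg` on the Hochschild complex. -/
noncomputable def homotopyHom (n : ℕ) :
    Z (⊥ : Subalgebra k A) M n →ₗ[k] Z (⊥ : Subalgebra k A) M (n + 1) :=
  ∑ j : Fin (n + 1), (-1 : k) ^ (j : ℕ) • S.homotopyTerm M j

/-- This face closes the junction just before the inserted 1, removing the 1 and absorbing the last
of the j + 1 insertions. -/
theorem face_homotopyTerm_self {n : ℕ} (j : Fin (n + 1)) :
    face ⊥ M j.castSucc ∘ₗ S.homotopyTerm M j = S.junctions M n j := by
  rw [homotopyTerm, ← LinearMap.comp_assoc,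
    S.face_junctions_of_lt j.castSucc j le_rfl (by omega), LinearMap.comp_assoc,
    face_degen_self, LinearMap.comp_id]

/-- This face closes the junction just after the inserted 1, which carries no insertion, so all j +
1 factors survive. -/
theorem face_homotopyTerm_succ {n : ℕ} (j : Fin (n + 1)) :
    face ⊥ M j.succ ∘ₗ S.homotopyTerm M j = S.junctions M n (j + 1) := by
  rw [homotopyTerm, ← LinearMap.comp_assoc,
    S.face_junctions_of_le j.succ (j + 1) le_rfl, LinearMap.comp_assoc,
    face_degen_succ, LinearMap.comp_id]

theorem face_homotopyTerm_of_le {n : ℕ} (i : Fin (n + 2)) (j : Fin (n + 1)) (h : (i : ℕ) ≤ j) :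
    face ⊥ M i.castSucc ∘ₗ S.homotopyTerm M j.succ = S.homotopyTerm M j ∘ₗ face ⊥ M i := by
  rw [homotopyTerm, homotopyTerm, ← LinearMap.comp_assoc,
    S.face_junctions_of_lt i.castSucc _ (by simp; omega) (by simp; omega),
    LinearMap.comp_assoc, face_degen_of_le i j h, ← LinearMap.comp_assoc]
  rfl

theorem face_homotopyTerm_of_lt {n : ℕ} (i : Fin (n + 2)) (j : Fin (n + 1)) (h : (j : ℕ) < i) :
    face ⊥ M i.succ ∘ₗ S.homotopyTerm M j.castSucc = S.homotopyTerm M j ∘ₗ face ⊥ M i := by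
  rw [homotopyTerm, homotopyTerm, ← LinearMap.comp_assoc,
    S.face_junctions_of_le i.succ _ (by simp; omega),
    LinearMap.comp_assoc, face_degen_of_lt i j h, ← LinearMap.comp_assoc]
  rfl

theorem neg_one_pow_smul_int {X : Type*} [AddCommGroup X] [Module k X] (m : ℕ) (x : X) :
    (-1 : k) ^ m • x = (-1 : ℤ) ^ m • x := by
  rcases Nat.even_or_odd m with h | h <;> simp [h.neg_one_pow]

theorem bMap_homotopyHom (n : ℕ) : bMap ⊥ M n ∘ₗ S.homotopyHom M n =
    ∑ j : Fin (n + 1), ∑ i : Fin (n + 2),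
      (-1 : ℤ) ^ ((i : ℕ) + j) • (face ⊥ M i ∘ₗ S.homotopyTerm M j) := by
  rw [bMap, homotopyHom, comp_sum']
  refine Finset.sum_congr rfl fun j _ => ?_
  rw [LinearMap.comp_smul, sum_comp', Finset.smul_sum]
  refine Finset.sum_congr rfl fun i _ => ?_
  rw [LinearMap.smul_comp, smul_smul, ← pow_add, add_comm (j : ℕ), neg_one_pow_smul_int]

theorem homotopyHom_bMap (n : ℕ) : S.homotopyHom M n ∘ₗ bMap ⊥ M n =
    ∑ j : Fin (n + 1), ∑ i : Fin (n + 2),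
      (-1 : ℤ) ^ ((i : ℕ) + j) • (S.homotopyTerm M j ∘ₗ face ⊥ M i) := by
  rw [bMap, homotopyHom, sum_comp']
  refine Finset.sum_congr rfl fun j _ => ?_
  rw [LinearMap.smul_comp, comp_sum', Finset.smul_sum]
  refine Finset.sum_congr rfl fun i _ => ?_
  rw [LinearMap.comp_smul, smul_smul, ← pow_add, add_comm (j : ℕ), neg_one_pow_smul_int]

theorem bMap_homotopyHom_zero : bMap ⊥ M 0 ∘ₗ S.homotopyHom M 0 = 1 - S.avg M 0 := by
  rw [bMap_homotopyHom]
  have h := sum_fin_alternating_homotopy 0 (fun i j => face ⊥ M i ∘ₗ S.homotopyTerm M j)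
    (fun _ j => j.elim0) (S.junctions M 0) S.face_homotopyTerm_self S.face_homotopyTerm_succ
    (fun _ j => j.elim0) (fun _ j => j.elim0)
  rw [Fin.sum_univ_zero, add_zero] at h
  exact h

theorem bMap_homotopyHom_succ (n : ℕ) :
    bMap ⊥ M (n + 1) ∘ₗ S.homotopyHom M (n + 1) + S.homotopyHom M n ∘ₗ bMap ⊥ M n =
      1 - S.avg M (n + 1) := by
  rw [bMap_homotopyHom, homotopyHom_bMap]
  exact sum_fin_alternating_homotopy (n + 1) (fun i j => face ⊥ M i ∘ₗ S.homotopyTerm M j)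
    (fun i j => S.homotopyTerm M j ∘ₗ face ⊥ M i) (S.junctions M (n + 1)) S.face_homotopyTerm_self
    S.face_homotopyTerm_succ S.face_homotopyTerm_of_le S.face_homotopyTerm_of_lt

end SepFamily

variable (k A) in
/-- The contracting homotopy of the complex with differential `b'`. -/
noncomputable def barHom (n : ℕ) :
    Z (⊥ : Subalgebra k A) M n →ₗ[k] Z (⊥ : Subalgebra k A) M (n + 1) :=
  (-1 : k) ^ n • degen k M A (Fin.last n)

theorem bMap'_barHom_zero : bMap' ⊥ M 0 ∘ₗ barHom k A M 0 = 1 := by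
  have h := face_degen_self (k := k) (M := M) (A := A) (Fin.last 0)
  simpa [bMap', barHom, Module.End.one_eq_id] using h

/-- Faces 0, …, n cross the last degeneracy, and their contributions cancel in pairs because the
sign of `barHom` changes with the degree. Face n + 1, the last one kept by b', undoes the insertion.
-/
theorem bMap'_barHom_succ (n : ℕ) :
    bMap' ⊥ M (n + 1) ∘ₗ barHom k A M (n + 1) + barHom k A M n ∘ₗ bMap' ⊥ M n = 1 := by
  have h : ∀ i : Fin (n + 1), face ⊥ M i.castSucc.castSucc ∘ₗ degen k M A (Fin.last (n + 1)) =
      degen k M A (Fin.last n) ∘ₗ face ⊥ M i.castSucc :=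
    fun i => face_degen_of_le i.castSucc (Fin.last n) (by simp; omega)
  rw [bMap', Fin.sum_univ_castSucc, LinearMap.add_comp, bMap', sum_comp', comp_sum', barHom, barHom]
  simp only [LinearMap.smul_comp, LinearMap.comp_smul, h, smul_smul, face_degen_self, ← pow_add,
    Fin.val_last, Fin.val_castSucc]
  rw [Even.neg_one_pow ⟨n + 1, rfl⟩, one_smul, add_right_comm, ← Finset.sum_add_distrib,
    Finset.sum_eq_zero, zero_add]
  · rfl
  · intro i _
    rw [← add_smul, add_right_comm, pow_succ, add_comm (i : ℕ), mul_neg_one, neg_add_cancel, zero_smul]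

variable {M}

/-- The homotopy from `1` to `S.avg` on the `p`-th column. -/
noncomputable def SepFamily.columnHomotopyHom (p n : ℕ) :
    Z (⊥ : Subalgebra k A) A n →ₗ[k] Z (⊥ : Subalgebra k A) A (n + 1) :=
  if Even p then S.homotopyHom A n else (1 - S.avg A (n + 1)) ∘ₗ barHom k A A n

theorem SepFamily.bMap'_one_sub_avg (n : ℕ) :
    bMap' ⊥ M n ∘ₗ (1 - S.avg M (n + 1)) = (1 - S.avg M n) ∘ₗ bMap' ⊥ M n := by
  rw [LinearMap.comp_sub, LinearMap.sub_comp, S.bMap'_avg, Module.End.one_eq_id,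
    Module.End.one_eq_id, LinearMap.id_comp, LinearMap.comp_id]

theorem SepFamily.colD_columnHomotopyHom_zero (p : ℕ) :
    colD ⊥ p 0 ∘ₗ S.columnHomotopyHom p 0 = 1 - S.avg A 0 := by
  unfold colD columnHomotopyHom
  split_ifs
  · exact S.bMap_homotopyHom_zero
  -- On odd columns 1 - `avg` commutes with b', so it factors out of the contraction identity.
  · rw [← LinearMap.comp_assoc, S.bMap'_one_sub_avg, LinearMap.comp_assoc, bMap'_barHom_zero]
    rfl

theorem SepFamily.colD_columnHomotopyHom_succ (p n : ℕ) :
    colD ⊥ p (n + 1) ∘ₗ S.columnHomotopyHom p (n + 1) + S.columnHomotopyHom p n ∘ₗ colD ⊥ p n =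
      1 - S.avg A (n + 1) := by
  unfold colD columnHomotopyHom
  split_ifs
  · exact S.bMap_homotopyHom_succ n
  · rw [← LinearMap.comp_assoc, S.bMap'_one_sub_avg, LinearMap.comp_assoc, LinearMap.comp_assoc,
      ← LinearMap.comp_add, bMap'_barHom_succ]
    rfl

end Retraction

/-- A homotopy to zero of a map of chain complexes indexed by `ℕ`, from its nonzero components. -/
noncomputable def homotopyZeroOfSucc {C : Type*} [Category* C] [Preadditive C]
    {X Y : ChainComplex C ℕ} {f : X ⟶ Y} (h : ∀ n, X.X n ⟶ Y.X (n + 1))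
    (h0 : f.f 0 = h 0 ≫ Y.d 1 0)
    (h1 : ∀ n, f.f (n + 1) = X.d (n + 1) n ≫ h n + h (n + 1) ≫ Y.d (n + 2) (n + 1)) :
    Homotopy f 0 :=
  -- The relation reads i + 1 = j, and `eqToHom` identifies the target in degree i + 1 with the one
  -- in degree j.
  have e : f = Homotopy.nullHomotopicMap' fun i j (e : (ComplexShape.down ℕ).Rel j i) =>
      h i ≫ eqToHom (congrArg Y.X e) := by
    ext n
    cases n with
    | zero =>
      rw [h0, Homotopy.nullHomotopicMap'_f_of_not_rel_left (k₁ := 1) (by simp) (by simp),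
        eqToHom_refl, Category.comp_id]
    | succ n =>
      rw [h1, Homotopy.nullHomotopicMap'_f (k₂ := n + 2) (k₀ := n) (by simp) (by simp),
        eqToHom_refl, eqToHom_refl, Category.comp_id, Category.comp_id]
  (Homotopy.ofEq e).trans (Homotopy.nullHomotopy' _)

/-! ### Chain maps, homotopies and the isomorphisms on homology. -/

section Complexes

variable {k : Type u} {A : Type v} [CommRing k] [Ring A] [Algebra k A] {B : Subalgebra k A}
variable (S : SepFamily B)
variable (M : Type w) [AddCommGroup M] [Module k M] [Module A M] [Module Aᵐᵒᵖ M]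
  [IsScalarTower k A M] [IsScalarTower k Aᵐᵒᵖ M] [SMulCommClass A Aᵐᵒᵖ M]

variable (B) in
theorem hochschildComplex_d (n : ℕ) :
    (hochschildComplex B M).d (n + 1) n = ModuleCat.ofHom (bMap B M n) := by
  simp only [hochschildComplex, ChainComplex.of_d]

variable (B) in
theorem column_d (p n : ℕ) :
    (column B p).d (n + 1) n = ModuleCat.ofHom (colD B p n) := by
  simp only [column, ChainComplex.of_d]

namespace SepFamily

/-- The section `C_*(A/B, M) → C_*(A/k, M)` of the canonical map. -/
noncomputable def hochschildExpand :
    hochschildComplex B M ⟶ hochschildComplex (⊥ : Subalgebra k A) M :=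
  ChainComplex.ofHom (fun n => ModuleCat.ofHom (S.expand M n)) fun n => by
    simp only [hochschildComplex, ChainComplex.of_d]
    rw [← ModuleCat.ofHom_comp, ← ModuleCat.ofHom_comp, bMap_expand]

/-- The section of the canonical map on the `p`-th column. -/
noncomputable def columnExpand (p : ℕ) : column B p ⟶ column (⊥ : Subalgebra k A) p :=
  ChainComplex.ofHom (fun n => ModuleCat.ofHom (S.expand A n)) fun n => by
    simp only [column, ChainComplex.of_d]
    rw [← ModuleCat.ofHom_comp, ← ModuleCat.ofHom_comp, colD_expand]

/-- The section of the canonical map of Tsygan double complexes. -/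
noncomputable def tsyganExpand : tsyganComplex B ⟶ tsyganComplex (⊥ : Subalgebra k A) :=
  ChainComplex.ofHom S.columnExpand fun p => by
    simp only [tsyganComplex, ChainComplex.of_d]
    ext n : 1
    change ModuleCat.ofHom (S.expand A n) ≫ ModuleCat.ofHom (rowD ⊥ p n) =
      ModuleCat.ofHom (rowD B p n) ≫ ModuleCat.ofHom (S.expand A n)
    rw [← ModuleCat.ofHom_comp, ← ModuleCat.ofHom_comp, rowD_expand]

theorem hochschildExpand_comp :
    S.hochschildExpand M ≫ hochschildComplexMap M bot_le = 𝟙 _ := by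
  ext n : 1
  change ModuleCat.ofHom (S.expand M n) ≫ ModuleCat.ofHom (projMap M _ n) = 𝟙 _
  rw [← ModuleCat.ofHom_comp, projMap_expand]
  rfl

theorem tsyganExpand_comp : S.tsyganExpand ≫ tsyganComplexMap bot_le = 𝟙 _ := by
  ext p n : 2
  change ModuleCat.ofHom (S.expand A n) ≫ ModuleCat.ofHom (projMap A _ n) = 𝟙 _
  rw [← ModuleCat.ofHom_comp, projMap_expand]
  rfl

/-- The canonical map followed by its section is homotopic to the identity. -/
noncomputable def hochschildHomotopy :
    Homotopy (𝟙 _ - hochschildComplexMap M bot_le ≫ S.hochschildExpand M) 0 :=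
  have key : ∀ n, (𝟙 _ - hochschildComplexMap M bot_le ≫ S.hochschildExpand M).f n =
      ModuleCat.ofHom (1 - S.avg M n) := fun n => by
    rw [← S.expand_projMap]
    rfl
  homotopyZeroOfSucc (fun n => ModuleCat.ofHom (S.homotopyHom M n))
    (by
      refine (key 0).trans ((congrArg ModuleCat.ofHom S.bMap_homotopyHom_zero.symm).trans ?_)
      rw [hochschildComplex_d]
      rfl)
    (fun n => by
      refine (key (n + 1)).trans ((congrArg ModuleCat.ofHom
        ((S.bMap_homotopyHom_succ n).symm.trans (add_comm _ _))).trans ?_)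
      rw [hochschildComplex_d, hochschildComplex_d]
      rfl)

/-- On every column the canonical map followed by its section is homotopic to the identity. -/
noncomputable def columnHomotopy (p : ℕ) :
    Homotopy ((𝟙 (tsyganComplex (⊥ : Subalgebra k A)) -
      tsyganComplexMap bot_le ≫ S.tsyganExpand).f p) 0 :=
  have key : ∀ n, ((𝟙 (tsyganComplex (⊥ : Subalgebra k A)) -
      tsyganComplexMap bot_le ≫ S.tsyganExpand).f p).f n =
      ModuleCat.ofHom (1 - S.avg A n) := fun n => by
    rw [← S.expand_projMap]
    rfl
  homotopyZeroOfSucc (X := column ⊥ p) (Y := column ⊥ p)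
    (fun n => ModuleCat.ofHom (S.columnHomotopyHom p n))
    (by
      refine (key 0).trans ((congrArg ModuleCat.ofHom
        (S.colD_columnHomotopyHom_zero p).symm).trans ?_)
      rw [column_d]
      rfl)
    (fun n => by
      refine (key (n + 1)).trans ((congrArg ModuleCat.ofHom
        ((S.colD_columnHomotopyHom_succ p n).symm.trans (add_comm _ _))).trans ?_)
      rw [column_d, column_d]
      rfl)

theorem isIso_HHMap (S : SepFamily B) (n : ℕ) : IsIso (HHMap M (bot_le : (⊥ : Subalgebra k A) ≤ B) n) := by
  refine ⟨HomologicalComplex.homologyMap (S.hochschildExpand M) n, ?_, ?_⟩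
  · have h := (S.hochschildHomotopy M).homologyMap_eq n
    rw [HomologicalComplex.homologyMap_sub, HomologicalComplex.homologyMap_id,
      HomologicalComplex.homologyMap_comp, HomologicalComplex.homologyMap_zero, sub_eq_zero] at h
    exact h.symm
  · refine (HomologicalComplex.homologyMap_comp _ _ n).symm.trans ?_
    rw [hochschildExpand_comp]
    exact HomologicalComplex.homologyMap_id _ n

theorem isIso_HCMap (S : SepFamily B) (n : ℕ) : IsIso (HCMap (bot_le : (⊥ : Subalgebra k A) ≤ B) n) :=
  isIso_homologyMap_total_map _ S.tsyganExpand S.tsyganExpand_comp S.columnHomotopy n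

end SepFamily
end Complexes
end RelCyclic

theorem mainTheorem12 {k : Type u} [Field k] {A : Type v} [Ring A] [Algebra k A]
    (B : Subalgebra k A) (hB : IsSeparableAlg k B) :
    (∀ (M : Type w) [AddCommGroup M] [Module k M] [Module A M] [Module Aᵐᵒᵖ M]
      [IsScalarTower k A M] [IsScalarTower k Aᵐᵒᵖ M] [SMulCommClass A Aᵐᵒᵖ M] (n : ℕ),
      IsIso (RelCyclic.HHMap M (bot_le : (⊥ : Subalgebra k A) ≤ B) n)) ∧
    (∀ n : ℕ, IsIso (RelCyclic.HCMap (bot_le : (⊥ : Subalgebra k A) ≤ B) n)) := by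
  obtain ⟨S⟩ := RelCyclic.exists_sepFamily hB
  exact ⟨fun M => by intros; exact RelCyclic.SepFamily.isIso_HHMap M S _, S.isIso_HCMap⟩
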